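/- A *symmetric channel* is a mixture of binary symmetric channels: it is given by a probability measure $\nu$ on $[0,1/2]$, and on input $x\in\mathbb F_2$ it draws $\epsilon\sim\nu$, then $w\sim\mathrm{Ber}(\epsilon)$ given $\epsilon$, and outputs $(\epsilon,x+w)$; distinct uses of the channel are independent. Its capacity $C$ is the supremum over input distributions of the mutual information, in bits, between input and output. The Reed–Muller code $RM(m,r)\subseteq\mathbb F_2^{n}$, $n=2^m$, is the linear code of all evaluation vectors on $\mathbb F_2^m$ of polynomials over $\mathbb F_2$ in $m$ variables of degree at most $r$; its rate is $\dim RM(m,r)/n$. For a linear code of length $n$, let $X$ be a codeword (random with an arbitrary law, e.g. uniform or deterministic), sent coordinate by coordinate over the channel, with noise independent of $X$ and output $Y=(Y_1,\dots,Y_n)$. Let $\hat X_i(Y)$ be a maximum likelihood decoder of the $i$-th coordinate of the codeword based on $Y$, i.e. $\hat X_i(y)$ is a value $b\in\mathbb F_2$ that maximizes the sum of the likelihoods of $y$ over all codewords whose $i$-th coordinate is $b$, with ties broken in any way. Put $P_{\mathrm{bit}}=\max_{i\in[n]}\mathbb P(X_i\neq\hat X_i(Y))$. **Corollary.** Let $\nu$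 be a symmetric channel of capacity $C$, and let $RM(m_k,r_k)$, $k\in\mathbb N$, be Reed–Muller codes with block lengths $n_k=2^{m_k}$, $m_k\to\infty$, and rates $R_k$ such that $\limsup_{k\to\infty}R_k<C$. Then for every choice of the laws of the transmitted codewords and of the maximum likelihood bit decoders, $$P_{\mathrm{bit}}=O\!\left(2^{-\sqrt{\log_2 n_k}/\log_2\log_2 n_k}\right)\qquad(k\to\infty).$$ -/

import Mathlib

open Filter MeasureTheory

noncomputable section

/-! ### Symmetric channels

A symmetric channel is a mixture of binary symmetric channels. It is given by a probability
measure `ν` on the interval `[0, 1/2]`: on input `x` it draws `ε ~ ν`, then `w ~ Ber(ε)`, and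
outputs the pair `(ε, x + w)`. Different uses of the channel are independent. -/

/-- The values of a crossover probability. -/
abbrev Crossover : Type := Set.Icc (0 : ℝ) (1 / 2)

/-- The output alphabet of a symmetric channel. A noise variable `(ε, w)` has the same type. -/
abbrev ChannelSymbol : Type := Crossover × ZMod 2

/-- The probability that a binary symmetric channel of crossover probability `ε` outputs `u` on
input `x`. As a function of `y = (ε, u)` this is the density of the output of a symmetric channel
on input `x` with respect to the product of `ν` and the counting measure. -/
def transition (x : ZMod 2) (y : ChannelSymbol) : ℝ :=
  if y.2 = x then 1 - (y.1 : ℝ) else (y.1 : ℝ)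

/-- The law of the noise `(ε, w)`, where `ε ~ ν` and, given `ε`, `w ~ Ber(ε)`. -/
def noiseLaw (ν : Measure Crossover) : Measure ChannelSymbol :=
  (ν.prod Measure.count).withDensity (fun z => ENNReal.ofReal (transition 0 z))

/-- The channel output on input `x` under the noise `z = (ε, w)`. -/
def channelOutput (x : ZMod 2) (z : ChannelSymbol) : ChannelSymbol := (z.1, x + z.2)

/-- The joint law of the input and the output of one use of the channel, for an input
distribution `p`. -/
def inputOutputLaw (ν : Measure Crossover) (p : Measure (ZMod 2)) :
    Measure (ZMod 2 × ChannelSymbol) :=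
  (p.prod (noiseLaw ν)).map (fun q => (q.1, channelOutput q.1 q.2))

/-- The capacity in bits: the supremum over all input distributions of the mutual information of
input and output, i.e. of the relative entropy of their joint law with respect to the product of
its marginals. -/
def capacity (ν : Measure Crossover) : ℝ :=
  (⨆ p : ProbabilityMeasure (ZMod 2),
    InformationTheory.klDiv (inputOutputLaw ν p)
      ((inputOutputLaw ν p).fst.prod (inputOutputLaw ν p).snd)).toReal / Real.log 2

/-! ### Linear codes and their bit-error probability -/

section Codes

variable {ι : Type} [Fintype ι]

/-- The rate of a binary linear code with coordinates indexed by `ι`. -/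
def codeRate (C : Submodule (ZMod 2) (ι → ZMod 2)) : ℝ :=
  (Module.finrank (ZMod 2) C : ℝ) / Fintype.card ι

open scoped Classical in
/-- The likelihood of `X_i = b` given `Y = y`, for a uniformly random codeword `X`: the sum of the
likelihoods of all codewords whose coordinate `i` is `b`. (The normalization is omitted: if both
values of `b` occur, they occur in the same number of codewords.) -/
def bitLikelihood (C : Submodule (ZMod 2) (ι → ZMod 2)) (i : ι) (b : ZMod 2)
    (y : ι → ChannelSymbol) : ℝ :=
  ∑ c : ι → ZMod 2 with c ∈ C ∧ c i = b, ∏ j, transition (c j) (y j)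

/-- `dec` is a maximum likelihood decoder of the coordinate `i` of the codeword from the whole
output `y`; ties may be broken in any way. -/
def IsMLBitDecoder (C : Submodule (ZMod 2) (ι → ZMod 2)) (i : ι)
    (dec : (ι → ChannelSymbol) → ZMod 2) : Prop :=
  ∀ (y : ι → ChannelSymbol) (b : ZMod 2), bitLikelihood C i b y ≤ bitLikelihood C i (dec y) y

/-- The probability of `X_i ≠ dec(Y)`, where the codeword `X` has law `p` and is transmitted over
the memoryless channel, the noise being independent of `X`. -/
def bitErrorProbAt (ν : Measure Crossover) (C : Submodule (ZMod 2) (ι → ZMod 2)) (p : PMF C)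
    (i : ι) (dec : (ι → ChannelSymbol) → ZMod 2) : ℝ :=
  (∑' c : C, p c * Measure.pi (fun _ : ι => noiseLaw ν)
    {z | dec (fun j => channelOutput (c.1 j) (z j)) ≠ c.1 i}).toReal

/-- The bit-error probability: the maximum over the coordinates `i` of the probability that the
decoder `dec i` of the coordinate `i` errs. -/
def bitErrorProb (ν : Measure Crossover) (C : Submodule (ZMod 2) (ι → ZMod 2)) (p : PMF C)
    (dec : ι → (ι → ChannelSymbol) → ZMod 2) : ℝ :=
  ⨆ i : ι, bitErrorProbAt ν C p i (dec i)

end Codes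

/-- The Reed–Muller code `RM(m, r)`: the evaluations on the `m`-dimensional Boolean cube of the
polynomials over `𝔽₂` in `m` variables of total degree at most `r`. -/
def reedMuller (m r : ℕ) : Submodule (ZMod 2) ((Fin m → ZMod 2) → ZMod 2) :=
  (MvPolynomial.restrictTotalDegree (Fin m) (ZMod 2) r).map (MvPolynomial.evalₗ (ZMod 2) (Fin m))

/-- The block length of `RM(m, r)`. -/
def blockLength (m : ℕ) : ℕ := 2 ^ m

end

/-! A weak prediction of one bit is obtained from an entropy count and then amplified by a majority
vote over many subspaces that meet only a little.

Weak prediction. Fix the crossover probabilities and let `f` be the sum of the likelihoods of all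
codewords, a function on the cube of received words. Below capacity the entropy of the output falls
short of that of the uniform law by an amount linear in the block length. A modified logarithmic
Sobolev inequality (`entropy_le_sum_flipEnergy`) bounds this deficit by the sum of the energies of
`f` in the coordinate directions, and the energy in direction `j` is controlled by the correlation
of bit `j` with its posterior mean given the other outputs (`half_flipEnergy_le`). Averaging over
`j` gives a coordinate whose correlation is at least `log 2` times the gap between capacity and rate
(`exists_le_integral_bitPredictor`).

Boosting. The weak predictor is used for the shorter code `RM(m - l, r)`, to which every codeword of
`RM(m, r)` restricts on affine subspaces. Identify the cube with the field of order `2 ^ m`, and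
take the multiples of one subspace of dimension `m - l` by all units, translated so that the weakly
predictable coordinate lands on a given point `i`. A point other than `i` lies on fewer than `2 ^ (m
- l)` of these roughly `2 ^ m` subspaces. The votes therefore depend so little on common noise that
the variance of their sum is small, and Chebyshev bounds the error of the majority vote by a
constant times `2 ^ (-l)`. Maximum likelihood decoding is worse by at most a factor 2.

Choice of `l`. Since binomial coefficients are at most `2 ^ m / √m`, shortening by `l` raises the
rate by at most `l / √m`. Hence `l` of order `√m` is allowed, which gives a bound of order `2 ^ (-δ
√m)`, stronger than required. -/

/-! ### Variance of a sum of functions with scattered supports -/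

section Variance

set_option linter.unusedSectionVars false

variable {ι α : Type*} [Fintype ι] [MeasurableSpace α]

/-- A measurable real function that is bounded. -/
def IsBddMeasurable {Ω : Type*} [MeasurableSpace Ω] (f : Ω → ℝ) : Prop :=
  Measurable f ∧ ∃ B, ∀ z, |f z| ≤ B

namespace IsBddMeasurable

variable {Ω : Type*} [MeasurableSpace Ω] {f g : Ω → ℝ}

theorem integrable (hf : IsBddMeasurable f) (P : Measure Ω) [IsFiniteMeasure P] :
    Integrable f P := by
  obtain ⟨hm, B, hB⟩ := hf
  exact Integrable.of_bound hm.aestronglyMeasurable B (ae_of_all _ hB)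

theorem const (c : ℝ) : IsBddMeasurable fun _ : Ω => c := ⟨measurable_const, |c|, fun _ => le_rfl⟩

theorem add (hf : IsBddMeasurable f) (hg : IsBddMeasurable g) :
    IsBddMeasurable fun z => f z + g z := by
  obtain ⟨hm, B, hB⟩ := hf
  obtain ⟨hm', B', hB'⟩ := hg
  exact ⟨hm.add hm', B + B', fun z => (abs_add_le _ _).trans (add_le_add (hB z) (hB' z))⟩

theorem mul (hf : IsBddMeasurable f) (hg : IsBddMeasurable g) :
    IsBddMeasurable fun z => f z * g z := by
  obtain ⟨hm, B, hB⟩ := hf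
  obtain ⟨hm', B', hB'⟩ := hg
  refine ⟨hm.mul hm', B * B', fun z => ?_⟩
  rw [abs_mul]
  exact mul_le_mul (hB z) (hB' z) (abs_nonneg _) ((abs_nonneg _).trans (hB z))

theorem sub (hf : IsBddMeasurable f) (hg : IsBddMeasurable g) :
    IsBddMeasurable fun z => f z - g z := by
  simpa [sub_eq_add_neg] using hf.add ((const (-1)).mul hg)

theorem sq (hf : IsBddMeasurable f) : IsBddMeasurable fun z => f z ^ 2 := by
  simpa [pow_two] using hf.mul hf

theorem sum {A : Type*} {s : Finset A} {f : A → Ω → ℝ} (hf : ∀ a ∈ s, IsBddMeasurable (f a)) :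
    IsBddMeasurable fun z => ∑ a ∈ s, f a z := by
  classical
  induction s using Finset.induction_on with
  | empty => simpa using const 0
  | insert a s ha ih =>
    simp only [Finset.sum_insert ha]
    exact (hf a (by simp)).add (ih fun b hb => hf b (by simp [hb]))

theorem comp {Ω' : Type*} [MeasurableSpace Ω'] {φ : Ω' → Ω} (hf : IsBddMeasurable f)
    (hφ : Measurable φ) : IsBddMeasurable fun z => f (φ z) :=
  ⟨hf.1.comp hφ, hf.2.imp fun _ hB z => hB (φ z)⟩

end IsBddMeasurable

variable [DecidableEq ι] (μ : Measure α) [IsProbabilityMeasure μ]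

/-- Resampling one coordinate preserves a product measure. -/
theorem measurePreserving_update (j : ι) :
    MeasurePreserving (fun p : (ι → α) × α => Function.update p.1 j p.2)
      ((Measure.pi fun _ : ι => μ).prod μ) (Measure.pi fun _ : ι => μ) := by
  have hm : Measurable (fun p : (ι → α) × α => Function.update p.1 j p.2) := by
    refine measurable_pi_lambda _ fun i => ?_
    by_cases h : i = j
    · subst h; simpa using measurable_snd
    · simp only [Function.update_of_ne h]; fun_prop
  refine ⟨hm, (Measure.pi_eq fun s hs => ?_).symm⟩
  rw [Measure.map_apply hm (MeasurableSet.univ_pi hs)]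
  have : (fun p : (ι → α) × α => Function.update p.1 j p.2) ⁻¹' (Set.univ.pi s) =
      (Set.univ.pi (Function.update s j Set.univ)) ×ˢ s j := by
    ext ⟨z, t⟩
    simp only [Set.mem_preimage, Set.mem_pi, Set.mem_univ, true_imp_iff, Set.mem_prod]
    constructor
    · intro h
      refine ⟨fun i => ?_, by simpa using h j⟩
      by_cases hi : i = j
      · subst hi; simp
      · simpa [Function.update_of_ne hi] using h i
    · rintro ⟨h, ht⟩ i
      by_cases hi : i = j
      · subst hi; simpa using ht
      · simpa [Function.update_of_ne hi] using h i
  rw [this, Measure.prod_prod, Measure.pi_pi, ← Finset.prod_erase_mul _ _ (Finset.mem_univ j),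
    ← Finset.prod_erase_mul _ (fun i => μ (s i)) (Finset.mem_univ j)]
  simp only [Function.update_self, measure_univ, mul_one]
  congr 1
  refine Finset.prod_congr rfl fun i hi => ?_
  rw [Function.update_of_ne (Finset.ne_of_mem_erase hi)]

/-- The average of `f` over the coordinate `j`. -/
noncomputable def coordAvg (j : ι) (f : (ι → α) → ℝ) (z : ι → α) : ℝ :=
  ∫ t, f (Function.update z j t) ∂μ

variable {μ}

theorem IsBddMeasurable.coordAvg {f : (ι → α) → ℝ} (hf : IsBddMeasurable f) (j : ι) :
    IsBddMeasurable (coordAvg μ j f) := by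
  obtain ⟨hm, B, hB⟩ := hf
  constructor
  · have h := hm.comp (measurePreserving_update μ j).measurable
    exact h.stronglyMeasurable.integral_prod_right'.measurable
  · refine ⟨B, fun z => ?_⟩
    have := norm_integral_le_of_norm_le_const (μ := μ) (f := fun t => f (Function.update z j t))
      (C := B) (ae_of_all _ fun t => hB _)
    simpa [_root_.coordAvg] using this

theorem integral_coordAvg {f : (ι → α) → ℝ} (hf : IsBddMeasurable f) (j : ι) :
    ∫ z, coordAvg μ j f z ∂(Measure.pi fun _ => μ) = ∫ z, f z ∂(Measure.pi fun _ => μ) := by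
  have hmp := measurePreserving_update (ι := ι) μ j
  rw [← hmp.map_eq, integral_map hmp.measurable.aemeasurable hf.1.aestronglyMeasurable,
    integral_prod _ ((hf.comp hmp.measurable).integrable _), hmp.map_eq]
  rfl

theorem coordAvg_update (j : ι) (f : (ι → α) → ℝ) (z : ι → α) (t : α) :
    coordAvg μ j f (Function.update z j t) = coordAvg μ j f z := by
  simp [coordAvg]

theorem coordAvg_eq_self {f : (ι → α) → ℝ} {j : ι}
    (hf : ∀ z t, f (Function.update z j t) = f z) : coordAvg μ j f = f := by
  ext z; simp [coordAvg, hf]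

theorem coordAvg_update_of_forall {f : (ι → α) → ℝ} {i : ι} (j : ι)
    (hf : ∀ z t, f (Function.update z i t) = f z) (z : ι → α) (t : α) :
    coordAvg μ j f (Function.update z i t) = coordAvg μ j f z := by
  by_cases h : i = j
  · subst h; exact coordAvg_update _ _ _ _
  · simp only [coordAvg, Function.update_comm h, hf]

/-- Pythagoras: averaging over a coordinate is an orthogonal projection in L². The cross term
reduces to the square of the average because the average no longer depends on that coordinate. -/
theorem integral_sub_coordAvg_sq {f : (ι → α) → ℝ} (hf : IsBddMeasurable f) (j : ι) :
    ∫ z, (f z - coordAvg μ j f z) ^ 2 ∂(Measure.pi fun _ => μ) =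
      ∫ z, f z ^ 2 ∂(Measure.pi fun _ => μ)
        - ∫ z, coordAvg μ j f z ^ 2 ∂(Measure.pi fun _ => μ) := by
  have hg := hf.coordAvg (μ := μ) j
  have key : ∫ z, f z * coordAvg μ j f z ∂(Measure.pi fun _ => μ) =
      ∫ z, coordAvg μ j f z ^ 2 ∂(Measure.pi fun _ => μ) := by
    rw [← integral_coordAvg (hf.mul hg) j]
    congr 1; ext z
    have : coordAvg μ j (fun z => f z * coordAvg μ j f z) z =
        ∫ t, f (Function.update z j t) * coordAvg μ j f (Function.update z j t) ∂μ := rfl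
    simp only [this, coordAvg_update]
    rw [integral_mul_const, pow_two]
    rfl
  have h1 := (hf.sq).integrable (Measure.pi fun _ : ι => μ)
  have h2 := (hg.sq).integrable (Measure.pi fun _ : ι => μ)
  have h3 := (hf.mul hg).integrable (Measure.pi fun _ : ι => μ)
  have : ∀ z, (f z - coordAvg μ j f z) ^ 2 =
      f z ^ 2 + coordAvg μ j f z ^ 2 - 2 * (f z * coordAvg μ j f z) := fun z => by ring
  simp only [this]
  rw [integral_sub (f := fun z => f z ^ 2 + coordAvg μ j f z ^ 2) (h1.add h2) (h3.const_mul 2),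
    integral_add h1 h2, integral_const_mul, key]
  ring

/-- Cauchy–Schwarz on the terms that can be nonzero; their number is where the bound `Q` on shared
coordinates enters. -/
theorem sum_ite_sq_le {A : Type*} [Fintype A] (p : A → Prop) [DecidablePred p] (x : A → ℝ)
    (hx : ∀ a, ¬ p a → x a = 0) :
    (∑ a, x a) ^ 2 ≤ (Finset.univ.filter p).card * ∑ a, x a ^ 2 := by
  have h1 : ∑ a, x a = ∑ a with p a, x a := by
    rw [Finset.sum_filter]
    exact Finset.sum_congr rfl fun a _ => by by_cases h : p a <;> simp [h, hx]
  have h2 : ∑ a with p a, x a ^ 2 ≤ ∑ a, x a ^ 2 :=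
    Finset.sum_le_univ_sum_of_nonneg fun a => sq_nonneg _
  rw [h1]
  exact sq_sum_le_card_mul_sum_sq.trans (by gcongr)

variable {A : Type*} [Fintype A]

/-- If each coordinate is used by at most `Q` of the functions `f a`, averaging out the coordinates
in `s` decreases the second moment of `∑ a, f a` by at most `Q` times the total decrease of the
second moments of the `f a`. -/
theorem exists_average {f : A → (ι → α) → ℝ} (hf : ∀ a, IsBddMeasurable (f a))
    (S : A → ι → Prop) [∀ a, DecidablePred (S a)]
    (hS : ∀ a j, ¬ S a j → ∀ z t, f a (Function.update z j t) = f a z) {Q : ℝ}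
    (hQ : ∀ j, ((Finset.univ.filter fun a => S a j).card : ℝ) ≤ Q) (s : Finset ι) :
    ∃ h : A → (ι → α) → ℝ, (∀ a, IsBddMeasurable (h a)) ∧
      (∀ a, ∫ z, h a z ∂(Measure.pi fun _ => μ) = ∫ z, f a z ∂(Measure.pi fun _ => μ)) ∧
      (∀ a j, ¬ S a j ∨ j ∈ s → ∀ z t, h a (Function.update z j t) = h a z) ∧
      (∫ z, (∑ a, f a z) ^ 2 ∂(Measure.pi fun _ => μ)
          - ∫ z, (∑ a, h a z) ^ 2 ∂(Measure.pi fun _ => μ) ≤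
        Q * ∑ a, (∫ z, f a z ^ 2 ∂(Measure.pi fun _ => μ)
          - ∫ z, h a z ^ 2 ∂(Measure.pi fun _ => μ))) := by
  induction s using Finset.induction_on with
  | empty => exact ⟨f, hf, fun _ => rfl, fun a j hj => hS a j (by simpa using hj), by simp⟩
  | insert j s hj ih =>
    obtain ⟨h, hb, hi, hd, hv⟩ := ih
    refine ⟨fun a => coordAvg μ j (h a), fun a => (hb a).coordAvg j,
      fun a => (integral_coordAvg (hb a) j).trans (hi a), fun a i hi z t => ?_, ?_⟩
    · by_cases hij : i = j
      · subst hij; exact coordAvg_update _ _ _ _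
      · refine coordAvg_update_of_forall j (hd a i ?_) z t
        simpa [hij] using hi
    · have hsum : ∀ z, ∑ a, coordAvg μ j (h a) z = coordAvg μ j (fun z => ∑ a, h a z) z := by
        intro z
        simp only [coordAvg]
        rw [integral_finsetSum]
        intro a _
        exact ((hb a).comp (measurable_update z)).integrable μ
      have hB : IsBddMeasurable fun z => ∑ a, h a z := IsBddMeasurable.sum fun a _ => hb a
      have e1 := integral_sub_coordAvg_sq (μ := μ) hB j
      have e2 : ∫ z, ((∑ a, h a z) - coordAvg μ j (fun z => ∑ a, h a z) z) ^ 2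
            ∂(Measure.pi fun _ => μ) ≤
          ∫ z, Q * ∑ a, (h a z - coordAvg μ j (h a) z) ^ 2 ∂(Measure.pi fun _ => μ) := by
        refine integral_mono ((hB.sub (hB.coordAvg j)).sq.integrable _)
          (((IsBddMeasurable.const Q).mul (IsBddMeasurable.sum fun a _ =>
            ((hb a).sub ((hb a).coordAvg j)).sq)).integrable _) fun z => ?_
        simp only [← hsum, ← Finset.sum_sub_distrib]
        -- A function that does not use the coordinate `j` is unchanged by averaging over it, so at
        -- most `Q` of the differences are nonzero.
        refine (sum_ite_sq_le (fun a => S a j) _ fun a ha => ?_).trans ?_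
        · rw [coordAvg_eq_self (hd a j (Or.inl ha)), sub_self]
        · gcongr
          exact hQ j
      have e3 : ∫ z, Q * ∑ a, (h a z - coordAvg μ j (h a) z) ^ 2 ∂(Measure.pi fun _ => μ) =
          Q * ∑ a, (∫ z, h a z ^ 2 ∂(Measure.pi fun _ => μ)
            - ∫ z, coordAvg μ j (h a) z ^ 2 ∂(Measure.pi fun _ => μ)) := by
        rw [integral_const_mul, integral_finsetSum _ fun a _ =>
          ((hb a).sub ((hb a).coordAvg j)).sq.integrable _]
        simp only [integral_sub_coordAvg_sq (hb _)]
      simp only [hsum]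
      have e4 : Q * ∑ a, (∫ z, f a z ^ 2 ∂(Measure.pi fun _ => μ)
            - ∫ z, coordAvg μ j (h a) z ^ 2 ∂(Measure.pi fun _ => μ)) =
          Q * ∑ a, (∫ z, f a z ^ 2 ∂(Measure.pi fun _ => μ)
            - ∫ z, h a z ^ 2 ∂(Measure.pi fun _ => μ)) +
          Q * ∑ a, (∫ z, h a z ^ 2 ∂(Measure.pi fun _ => μ)
            - ∫ z, coordAvg μ j (h a) z ^ 2 ∂(Measure.pi fun _ => μ)) := by
        rw [← mul_add, ← Finset.sum_add_distrib]
        simp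
      rw [e4]
      linarith

theorem eq_of_forall_update {f : (ι → α) → ℝ}
    (hf : ∀ j z t, f (Function.update z j t) = f z) (z z' : ι → α) : f z = f z' := by
  have : ∀ s : Finset ι, f (s.piecewise z z') = f z' := by
    intro s
    induction s using Finset.induction_on with
    | empty => simp
    | insert j s hj ih => rw [Finset.piecewise_insert, hf, ih]
  simpa using this Finset.univ

/-- If each coordinate is used by at most `Q` of the functions `f a`, the variance of their sum is
at most `Q` times the sum of their second moments. -/
theorem integral_sum_sub_sq_le {f : A → (ι → α) → ℝ} (hf : ∀ a, IsBddMeasurable (f a))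
    (S : A → ι → Prop) [∀ a, DecidablePred (S a)]
    (hS : ∀ a j, ¬ S a j → ∀ z t, f a (Function.update z j t) = f a z) {Q : ℝ} (hQ0 : 0 ≤ Q)
    (hQ : ∀ j, ((Finset.univ.filter fun a => S a j).card : ℝ) ≤ Q) :
    ∫ z, ((∑ a, f a z) - ∑ a, ∫ z, f a z ∂(Measure.pi fun _ => μ)) ^ 2
        ∂(Measure.pi fun _ => μ) ≤
      Q * ∑ a, ∫ z, f a z ^ 2 ∂(Measure.pi fun _ => μ) := by
  obtain ⟨h, hb, hi, hd, hv⟩ := exists_average (μ := μ) hf S hS hQ Finset.univ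
  have hB : IsBddMeasurable fun z => ∑ a, f a z := IsBddMeasurable.sum fun a _ => hf a
  -- After all coordinates have been averaged out, each function is the constant equal to its mean,
  -- so the total decrease of the second moment of the sum is its variance.
  have hc : ∀ a z, h a z = ∫ z, f a z ∂(Measure.pi fun _ => μ) := by
    intro a z
    rw [← hi a]
    have : h a = fun _ => h a z :=
      funext fun z' => eq_of_forall_update (fun j => hd a j (by simp)) _ _
    rw [this]; simp
  set m := ∑ a, ∫ z, f a z ∂(Measure.pi fun _ => μ) with hm
  have hF : ∫ z, ∑ a, f a z ∂(Measure.pi fun _ => μ) = m :=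
    integral_finsetSum _ fun a _ => (hf a).integrable _
  have h1 : ∫ z, ((∑ a, f a z) - m) ^ 2 ∂(Measure.pi fun _ => μ) =
      ∫ z, (∑ a, f a z) ^ 2 ∂(Measure.pi fun _ => μ) - m ^ 2 := by
    have : ∀ z, ((∑ a, f a z) - m) ^ 2 = (∑ a, f a z) ^ 2 - (2 * m * ∑ a, f a z - m ^ 2) :=
      fun z => by ring
    simp only [this]
    have i1 := hB.integrable (Measure.pi fun _ : ι => μ)
    rw [integral_sub (g := fun z => 2 * m * ∑ a, f a z - m ^ 2) (hB.sq.integrable _)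
      ((i1.const_mul _).sub (integrable_const _)), integral_sub (i1.const_mul _) (integrable_const _), integral_const_mul, hF]
    simp; ring
  have h2 : ∫ z, (∑ a, h a z) ^ 2 ∂(Measure.pi fun _ => μ) = m ^ 2 := by
    simp [hc, hm]
  rw [h1, ← h2]
  refine hv.trans (mul_le_mul_of_nonneg_left (Finset.sum_le_sum fun a _ => ?_) hQ0)
  have : 0 ≤ ∫ z, h a z ^ 2 ∂(Measure.pi fun _ => μ) := integral_nonneg fun z => sq_nonneg _
  linarith

/-- Chebyshev's inequality for a sum of functions with scattered supports. -/
theorem measureReal_sum_nonpos_le [Nonempty A] {f : A → (ι → α) → ℝ}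
    (hf : ∀ a, Measurable (f a)) (hf1 : ∀ a z, |f a z| ≤ 1)
    (S : A → ι → Prop) [∀ a, DecidablePred (S a)]
    (hS : ∀ a j, ¬ S a j → ∀ z t, f a (Function.update z j t) = f a z) {Q : ℝ} (hQ0 : 0 ≤ Q)
    (hQ : ∀ j, ((Finset.univ.filter fun a => S a j).card : ℝ) ≤ Q) {δ : ℝ} (hδ : 0 < δ)
    (hmean : ∀ a, δ ≤ ∫ z, f a z ∂(Measure.pi fun _ => μ)) :
    (Measure.pi fun _ => μ).real {z | ∑ a, f a z ≤ 0} ≤ Q / (Fintype.card A * δ ^ 2) := by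
  have hb : ∀ a, IsBddMeasurable (f a) := fun a => ⟨hf a, 1, hf1 a⟩
  have hV := integral_sum_sub_sq_le (μ := μ) hb S hS hQ0 hQ
  set m := ∑ a, ∫ z, f a z ∂(Measure.pi fun _ => μ) with hm
  have hcard : (0 : ℝ) < Fintype.card A := by exact_mod_cast Fintype.card_pos
  have hm' : Fintype.card A * δ ≤ m := by
    rw [hm, ← nsmul_eq_mul, ← Finset.card_univ]
    exact Finset.card_nsmul_le_sum _ _ _ fun a _ => hmean a
  have hsq : ∑ a, ∫ z, f a z ^ 2 ∂(Measure.pi fun _ => μ) ≤ Fintype.card A := by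
    rw [← Finset.card_univ, ← nsmul_one]
    refine Finset.sum_le_card_nsmul _ _ _ fun a _ => ?_
    calc ∫ z, f a z ^ 2 ∂(Measure.pi fun _ => μ) ≤ ∫ z, (1 : ℝ) ∂(Measure.pi fun _ : ι => μ) :=
          integral_mono ((hb a).sq.integrable _) (integrable_const _) fun z =>
            (sq_le_one_iff_abs_le_one _).2 (hf1 a z)
      _ = 1 := by simp
  have hB : IsBddMeasurable fun z => (∑ a, f a z) - m :=
    (IsBddMeasurable.sum fun a _ => hb a).sub (.const m)
  have hM := mul_meas_ge_le_integral_of_nonneg (μ := Measure.pi fun _ : ι => μ)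
    (ae_of_all _ fun z => sq_nonneg ((∑ a, f a z) - m)) (hB.sq.integrable _)
    ((Fintype.card A * δ) ^ 2)
  have hpos : 0 < (Fintype.card A * δ) ^ 2 := by positivity
  have hsub : (Measure.pi fun _ => μ).real {z | ∑ a, f a z ≤ 0} ≤
      (Measure.pi fun _ => μ).real {z | (Fintype.card A * δ) ^ 2 ≤ ((∑ a, f a z) - m) ^ 2} := by
    refine measureReal_mono fun z hz => ?_
    have hz' : ∑ a, f a z ≤ 0 := hz
    have h0 : 0 ≤ Fintype.card A * δ := by positivity
    show (Fintype.card A * δ) ^ 2 ≤ ((∑ a, f a z) - m) ^ 2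
    nlinarith
  have hfin : (Fintype.card A * δ) ^ 2 * (Measure.pi fun _ => μ).real {z | ∑ a, f a z ≤ 0} ≤
      Q * Fintype.card A :=
    calc _ ≤ _ := mul_le_mul_of_nonneg_left hsub hpos.le
      _ ≤ _ := hM
      _ ≤ _ := hV
      _ ≤ _ := by gcongr
  rw [le_div_iff₀ (by positivity)]
  have : Fintype.card A * ((Measure.pi fun _ => μ).real {z | ∑ a, f a z ≤ 0} *
      (Fintype.card A * δ ^ 2)) ≤ Fintype.card A * Q := by linarith
  exact le_of_mul_le_mul_left this hcard

/-- Reading a product measure along an injective map of coordinates gives a product measure. -/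
theorem measurePreserving_comp_injective {κ : Type*} [Fintype κ] {φ : κ → ι}
    (hφ : Function.Injective φ) :
    MeasurePreserving (fun (z : ι → α) k => z (φ k)) (Measure.pi fun _ => μ)
      (Measure.pi fun _ => μ) := by
  have hm : Measurable (fun (z : ι → α) k => z (φ k)) := by fun_prop
  refine ⟨hm, (Measure.pi_eq fun s hs => ?_).symm⟩
  rw [Measure.map_apply hm (MeasurableSet.univ_pi hs)]
  -- Coordinates outside the range of `φ` are unconstrained, and each contributes a factor 1.
  have : (fun (z : ι → α) k => z (φ k)) ⁻¹' (Set.univ.pi s) =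
      Set.univ.pi (Function.extend φ s fun _ => Set.univ) := by
    ext z
    simp only [Set.mem_preimage, Set.mem_pi, Set.mem_univ, true_imp_iff]
    constructor
    · intro h i
      by_cases hi : ∃ k, φ k = i
      · obtain ⟨k, rfl⟩ := hi
        rw [hφ.extend_apply]; exact h k
      · rw [Function.extend_apply' _ _ _ hi]; trivial
    · intro h k
      have := h (φ k)
      rwa [hφ.extend_apply] at this
  rw [this, Measure.pi_pi]
  calc ∏ i, μ (Function.extend φ s (fun _ => Set.univ) i)
      = ∏ i ∈ Finset.univ.image φ, μ (Function.extend φ s (fun _ => Set.univ) i) := by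
        refine (Finset.prod_subset (Finset.subset_univ _) fun i _ hi => ?_).symm
        rw [Function.extend_apply' _ _ _ (by simpa using hi), measure_univ]
    _ = ∏ k, μ (s k) := by
        rw [Finset.prod_image hφ.injOn]
        simp [hφ.extend_apply]

end Variance

/-! ### An entropy inequality on the Boolean cube -/

section Cube

/-- Apply `log x ≤ x - 1` to the ratios of `a` and `b` to their mean. This bounds the entropy lost
when two neighbouring values are replaced by their mean. -/
theorem mul_log_add_mul_log_sub_le {a b : ℝ} (ha : 0 ≤ a) (hb : 0 ≤ b) :
    a * Real.log a + b * Real.log b - 2 * ((a + b) / 2 * Real.log ((a + b) / 2)) ≤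
      (a - b) ^ 2 / (a + b) := by
  rcases eq_or_lt_of_le (add_nonneg ha hb) with h | h
  · have h1 : a = 0 := by linarith
    have h2 : b = 0 := by linarith
    simp [h1, h2]
  have key : ∀ x, 0 ≤ x → x * Real.log x - x * Real.log ((a + b) / 2) ≤
      x * (x / ((a + b) / 2) - 1) := by
    intro x hx
    rcases eq_or_lt_of_le hx with h0 | h0
    · simp [← h0]
    · rw [← mul_sub, ← Real.log_div h0.ne' (by positivity)]
      exact mul_le_mul_of_nonneg_left (Real.log_le_sub_one_of_pos (by positivity)) hx
  have e : a * (a / ((a + b) / 2) - 1) + b * (b / ((a + b) / 2) - 1) = (a - b) ^ 2 / (a + b) := by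
    field_simp; ring
  linarith [key a ha, key b hb]

/-- Joint convexity and homogeneity of `s ^ 2 / t`. The last two hypotheses are needed because a
quotient with denominator 0 is 0, which would drop a term from the right-hand side. -/
theorem add_sq_div_add_le {s s' t t' : ℝ} (ht : 0 ≤ t) (ht' : 0 ≤ t') (h : t = 0 → s = 0)
    (h' : t' = 0 → s' = 0) : (s + s') ^ 2 / (t + t') ≤ s ^ 2 / t + s' ^ 2 / t' := by
  rcases eq_or_lt_of_le ht with h0 | h0
  · simp [h h0.symm, ← h0]
  rcases eq_or_lt_of_le ht' with h0' | h0'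
  · simp [h' h0'.symm, ← h0']
  rw [div_add_div _ _ h0.ne' h0'.ne', div_le_div_iff₀ (by positivity) (by positivity)]
  nlinarith [sq_nonneg (s * t' - s' * t), mul_pos h0 h0']

variable {ι : Type*} [DecidableEq ι]

/-- The point of the cube that differs from `u` in the coordinate `j` only. -/
def flipAt (j : ι) (u : ι → ZMod 2) : ι → ZMod 2 := u + Pi.single j 1

theorem flipAt_flipAt (j : ι) (u : ι → ZMod 2) : flipAt j (flipAt j u) = u := by
  unfold flipAt
  rw [add_assoc, ← Pi.single_add]
  simp [show (1 : ZMod 2) + 1 = 0 from rfl]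

theorem flipAt_comm (i j : ι) (u : ι → ZMod 2) : flipAt i (flipAt j u) = flipAt j (flipAt i u) :=
  add_right_comm _ _ _

theorem flipAt_self (j : ι) (u : ι → ZMod 2) : flipAt j u j = u j + 1 := by simp [flipAt]

theorem flipAt_of_ne {i j : ι} (h : i ≠ j) (u : ι → ZMod 2) : flipAt j u i = u i := by
  simp [flipAt, h]

variable [Fintype ι]

theorem sum_flipAt (j : ι) (F : (ι → ZMod 2) → ℝ) : ∑ u, F (flipAt j u) = ∑ u, F u :=
  Equiv.sum_comp (Function.Involutive.toPerm (flipAt j) (flipAt_flipAt j)) F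

/-- The energy of `f` in the direction `j`. -/
noncomputable def flipEnergy (j : ι) (f : (ι → ZMod 2) → ℝ) : ℝ :=
  ∑ u, (f u - f (flipAt j u)) ^ 2 / (f u + f (flipAt j u))

/-- Flips commute, so this is convexity of `s ^ 2 / t`. It allows coordinates to be averaged one by
one while every loss is charged to the energies of the original function. -/
theorem flipEnergy_average_le {f : (ι → ZMod 2) → ℝ} (hf : ∀ u, 0 ≤ f u) (i j : ι) :
    flipEnergy j (fun u => (f u + f (flipAt i u)) / 2) ≤ flipEnergy j f := by
  have h : ∀ u, ((f u + f (flipAt i u)) / 2 -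
        (f (flipAt j u) + f (flipAt i (flipAt j u))) / 2) ^ 2 /
        ((f u + f (flipAt i u)) / 2 + (f (flipAt j u) + f (flipAt i (flipAt j u))) / 2) ≤
      ((f u - f (flipAt j u)) ^ 2 / (f u + f (flipAt j u)) +
      (f (flipAt i u) - f (flipAt j (flipAt i u))) ^ 2 /
        (f (flipAt i u) + f (flipAt j (flipAt i u)))) / 2 := by
    intro u
    rw [flipAt_comm i j]
    have h0 : ∀ v, f v + f (flipAt j v) = 0 → f v - f (flipAt j v) = 0 := by
      intro v hv
      linarith [hf v, hf (flipAt j v)]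
    have := add_sq_div_add_le (add_nonneg (hf u) (hf (flipAt j u)))
      (add_nonneg (hf (flipAt i u)) (hf (flipAt j (flipAt i u)))) (h0 u) (h0 _)
    refine le_trans (le_of_eq ?_) (div_le_div_of_nonneg_right this zero_le_two)
    rw [show ∀ a b c d : ℝ, ((a + b) / 2 - (c + d) / 2) ^ 2 = ((a - c) + (b - d)) ^ 2 / 4 by
      intros; ring, show ∀ a b c d : ℝ, (a + b) / 2 + (c + d) / 2 = ((a + c) + (b + d)) / 2 by
      intros; ring, div_div_div_eq, div_div]
    rw [show ∀ x : ℝ, 4 * x = 2 * (x * 2) by intros; ring, mul_comm (_ ^ 2) (2 : ℝ),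
      mul_div_mul_left _ _ two_ne_zero]
  refine (Finset.sum_le_sum fun u _ => h u).trans (le_of_eq ?_)
  rw [← Finset.sum_div, Finset.sum_add_distrib, sum_flipAt i fun v =>
    (f v - f (flipAt j v)) ^ 2 / (f v + f (flipAt j v))]
  simp [flipEnergy]

/-- Averaging in direction `j` costs at most half of the current energy in that direction, and
earlier averagings have not increased this energy. -/
theorem exists_cube_average {f : (ι → ZMod 2) → ℝ} (hf : ∀ u, 0 ≤ f u) (s : Finset ι) :
    ∃ h : (ι → ZMod 2) → ℝ, (∀ u, 0 ≤ h u) ∧ ∑ u, h u = ∑ u, f u ∧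
      (∀ j ∈ s, ∀ u, h (flipAt j u) = h u) ∧ (∀ j, flipEnergy j h ≤ flipEnergy j f) ∧
      ∑ u, f u * Real.log (f u) - ∑ u, h u * Real.log (h u) ≤
        (∑ j ∈ s, flipEnergy j f) / 2 := by
  induction s using Finset.induction_on with
  | empty => exact ⟨f, hf, rfl, by simp, fun _ => le_rfl, by simp⟩
  | insert j s hj ih =>
    obtain ⟨h, h0, hsum, hinv, hen, hent⟩ := ih
    refine ⟨fun u => (h u + h (flipAt j u)) / 2, fun u => ?_, ?_, ?_, fun i => ?_, ?_⟩
    · linarith [h0 u, h0 (flipAt j u)]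
    · rw [← Finset.sum_div, Finset.sum_add_distrib, sum_flipAt, ← hsum]; ring
    · intro i hi u
      rcases Finset.mem_insert.1 hi with rfl | hi
      · simp only [flipAt_flipAt, add_comm]
      · simp only [flipAt_comm j i, hinv i hi]
    · exact (flipEnergy_average_le h0 j i).trans (hen i)
    · rw [Finset.sum_insert hj, add_div]
      -- The sum over `u` meets each edge in direction `j` twice, whence the factor 1/2 in the
      -- conclusion.
      have h1 : ∑ u, (h u * Real.log (h u) + h (flipAt j u) * Real.log (h (flipAt j u)) -
          2 * ((h u + h (flipAt j u)) / 2 * Real.log ((h u + h (flipAt j u)) / 2))) ≤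
          flipEnergy j h :=
        Finset.sum_le_sum fun u _ => mul_log_add_mul_log_sub_le (h0 _) (h0 _)
      rw [Finset.sum_sub_distrib, Finset.sum_add_distrib,
        sum_flipAt j fun v => h v * Real.log (h v), ← Finset.mul_sum] at h1
      linarith [hen j]

/-- A modified logarithmic Sobolev inequality for the Boolean cube. -/
theorem entropy_le_sum_flipEnergy {f : (ι → ZMod 2) → ℝ} (hf : ∀ u, 0 ≤ f u)
    (hpos : 0 < ∑ u, f u) :
    ∑ u, f u * Real.log (f u) - (∑ u, f u) * Real.log (∑ u, f u)
        + (∑ u, f u) * (Fintype.card ι * Real.log 2) ≤ (∑ j, flipEnergy j f) / 2 := by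
  obtain ⟨h, h0, hsum, hinv, -, hent⟩ := exists_cube_average hf Finset.univ
  have hc : ∀ u, h u = h 0 := by
    intro u
    -- Every point is reached from 0 by flipping the coordinates at which it is 1.
    have : ∀ s : Finset ι, h (∑ j ∈ s, Pi.single j (u j)) = h 0 := by
      intro s
      induction s using Finset.induction_on with
      | empty => simp
      | insert j s hj ih =>
        rw [Finset.sum_insert hj, add_comm]
        have : u j = 0 ∨ u j = 1 := by generalize u j = x; revert x; decide
        rcases this with h' | h'
        · simpa [h'] using ih
        · rw [h']; exact (hinv j (Finset.mem_univ _) _).trans ih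
    simpa [Finset.univ_sum_single] using this Finset.univ
  have hcard : ((Fintype.card (ι → ZMod 2) : ℕ) : ℝ) = 2 ^ Fintype.card ι := by simp
  have hs : ∑ u, f u = 2 ^ Fintype.card ι * h 0 := by
    rw [← hsum, Finset.sum_congr rfl fun u _ => hc u, Finset.sum_const, nsmul_eq_mul,
      Finset.card_univ, hcard]
  have hl : ∑ u, h u * Real.log (h u) = 2 ^ Fintype.card ι * (h 0 * Real.log (h 0)) := by
    rw [Finset.sum_congr rfl fun u _ => by rw [hc u], Finset.sum_const, nsmul_eq_mul,
      Finset.card_univ, hcard]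
  have hh : h 0 ≠ 0 := by rintro h'; rw [hs, h'] at hpos; simp at hpos
  have hlog : Real.log (∑ u, f u) = Fintype.card ι * Real.log 2 + Real.log (h 0) := by
    rw [hs, Real.log_mul (by positivity) hh, Real.log_pow]
  rw [hl] at hent
  rw [hlog, hs]
  rw [← mul_assoc] at hent
  linarith

end Cube

/-! ### The capacity of a symmetric channel -/

section Capacity

set_option linter.unusedSectionVars false

open scoped ENNReal

theorem transition_nonneg (x : ZMod 2) (y : ChannelSymbol) : 0 ≤ transition x y := by
  have h := y.1.2
  unfold transition
  split_ifs
  · linarith [h.1, h.2]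
  · exact h.1

theorem transition_le_one (x : ZMod 2) (y : ChannelSymbol) : transition x y ≤ 1 := by
  have h := y.1.2
  unfold transition
  split_ifs
  · linarith [h.1, h.2]
  · linarith [h.1, h.2]

/-- The symmetry of the channel: translating input and received bit together preserves likelihoods.
Through it, every transmitted codeword reduces to the zero codeword. -/
theorem transition_add (x b : ZMod 2) (y : ChannelSymbol) :
    transition (x + b) (channelOutput x y) = transition b y := by
  simp [transition, channelOutput]

theorem sum_zmod_two {M : Type*} [AddCommMonoid M] (F : ZMod 2 → M) : ∑ x, F x = F 0 + F 1 :=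
  Fin.sum_univ_two F

theorem sum_transition (x : ZMod 2) (e : Crossover) : ∑ u, transition x (e, u) = 1 := by
  have hx : x = 0 ∨ x = 1 := by revert x; decide
  rcases hx with rfl | rfl <;> simp [sum_zmod_two, transition]

theorem measurable_transition : Measurable fun q : ZMod 2 × ChannelSymbol => transition q.1 q.2 := by
  unfold transition
  refine Measurable.ite ?_ (by fun_prop) (by fun_prop)
  exact measurableSet_eq_fun (by fun_prop) (by fun_prop)

theorem measurable_transition_right (x : ZMod 2) : Measurable (transition x) :=
  measurable_transition.comp measurable_prodMk_left

theorem measurable_channelOutput : Measurable fun q : ZMod 2 × ChannelSymbol =>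
    channelOutput q.1 q.2 := by
  unfold channelOutput
  refine Measurable.prodMk (by fun_prop) ?_
  exact (measurable_of_finite fun q : ZMod 2 × ZMod 2 => q.1 + q.2).comp
    (f := fun q : ZMod 2 × ChannelSymbol => (q.1, q.2.2)) (by fun_prop)

theorem measurable_channelOutput_right (x : ZMod 2) : Measurable (channelOutput x) :=
  measurable_channelOutput.comp measurable_prodMk_left

variable (ν : Measure Crossover) [IsProbabilityMeasure ν]

theorem lintegral_prod_count {F : ChannelSymbol → ℝ≥0∞} (hF : Measurable F) :
    ∫⁻ y, F y ∂(ν.prod Measure.count) = ∫⁻ e, ∑ u, F (e, u) ∂ν := by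
  rw [lintegral_prod _ hF.aemeasurable]
  simp [lintegral_count]

theorem map_channelOutput (x : ZMod 2) : (noiseLaw ν).map (channelOutput x) =
    (ν.prod Measure.count).withDensity fun y => ENNReal.ofReal (transition x y) := by
  have h0 := (measurable_transition_right 0).ennreal_ofReal
  have hx := (measurable_transition_right x).ennreal_ofReal
  refine Measure.ext_of_lintegral _ fun F hF => ?_
  have hFc : Measurable fun z => F (channelOutput x z) :=
    hF.comp (measurable_channelOutput_right x)
  rw [lintegral_map hF (measurable_channelOutput_right x), noiseLaw,
    lintegral_withDensity_eq_lintegral_mul _ h0 hFc, lintegral_withDensity_eq_lintegral_mul _ hx hF,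
    lintegral_prod_count _ (h0.mul hFc), lintegral_prod_count _ (hx.mul hF)]
  refine lintegral_congr fun e => ?_
  rw [← Equiv.sum_comp (Equiv.addLeft x)
    fun u => ((fun y => ENNReal.ofReal (transition x y)) * F) (e, u)]
  refine Finset.sum_congr rfl fun u _ => ?_
  have := transition_add x 0 (e, u)
  rw [add_zero] at this
  simp only [Pi.mul_apply, Equiv.coe_addLeft]
  rw [← this]
  rfl

instance isProbabilityMeasure_noiseLaw : IsProbabilityMeasure (noiseLaw ν) := by
  constructor
  rw [noiseLaw, withDensity_apply _ MeasurableSet.univ, Measure.restrict_univ,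
    lintegral_prod_count _ (measurable_transition_right 0).ennreal_ofReal]
  have : ∀ e : Crossover, ∑ u, ENNReal.ofReal (transition 0 (e, u)) = 1 := fun e => by
    rw [← ENNReal.ofReal_sum_of_nonneg fun u _ => transition_nonneg _ _, sum_transition]
    simp
  simp [this]

variable (p : Measure (ZMod 2)) [IsProbabilityMeasure p]

theorem inputOutputLaw_eq_withDensity : inputOutputLaw ν p =
    (p.prod (ν.prod Measure.count)).withDensity
      fun q => ENNReal.ofReal (transition q.1 q.2) := by
  have ht := measurable_transition.ennreal_ofReal
  have hm : Measurable fun q : ZMod 2 × ChannelSymbol => (q.1, channelOutput q.1 q.2) :=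
    measurable_fst.prodMk measurable_channelOutput
  refine Measure.ext_of_lintegral _ fun F hF => ?_
  have hFm : Measurable fun q : ZMod 2 × ChannelSymbol => F (q.1, channelOutput q.1 q.2) :=
    hF.comp hm
  rw [inputOutputLaw, lintegral_map hF hm, lintegral_withDensity_eq_lintegral_mul _ ht hF,
    lintegral_prod _ hFm.aemeasurable, lintegral_prod _ (ht.mul hF).aemeasurable]
  refine lintegral_congr fun x => ?_
  have hFx : Measurable fun y => F (x, y) := hF.comp measurable_prodMk_left
  have := lintegral_map (μ := noiseLaw ν) hFx (measurable_channelOutput_right x)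
  rw [← this, map_channelOutput, lintegral_withDensity_eq_lintegral_mul _
    (measurable_transition_right x).ennreal_ofReal hFx]
  rfl

instance isProbabilityMeasure_inputOutputLaw : IsProbabilityMeasure (inputOutputLaw ν p) :=
  Measure.isProbabilityMeasure_map
    (measurable_fst.prodMk measurable_channelOutput).aemeasurable

theorem fst_inputOutputLaw : (inputOutputLaw ν p).fst = p := by
  rw [inputOutputLaw, Measure.fst, Measure.map_map measurable_fst
    (measurable_fst.prodMk measurable_channelOutput)]
  exact Measure.fst_prod

theorem lintegral_zmod_two (F : ZMod 2 → ℝ≥0∞) :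
    ∫⁻ x, F x ∂p = ∑ x, ENNReal.ofReal (p.real {x}) * F x := by
  rw [lintegral_fintype]
  simp [mul_comm]

/-- The density of the channel output for the input distribution `p`. -/
noncomputable def outputDensity (y : ChannelSymbol) : ℝ := ∑ x, p.real {x} * transition x y

theorem outputDensity_nonneg (y : ChannelSymbol) : 0 ≤ outputDensity p y :=
  Finset.sum_nonneg fun _ _ => mul_nonneg measureReal_nonneg (transition_nonneg _ _)

theorem measurable_outputDensity : Measurable (outputDensity p) :=
  Finset.measurable_sum _ fun x _ => (measurable_transition_right x).const_mul _

theorem snd_inputOutputLaw : (inputOutputLaw ν p).snd =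
    (ν.prod Measure.count).withDensity fun y => ENNReal.ofReal (outputDensity p y) := by
  have ht := measurable_transition.ennreal_ofReal
  refine Measure.ext_of_lintegral _ fun F hF => ?_
  have hFs : Measurable fun q : ZMod 2 × ChannelSymbol => F q.2 := hF.comp measurable_snd
  rw [Measure.snd, lintegral_map hF measurable_snd, inputOutputLaw_eq_withDensity,
    lintegral_withDensity_eq_lintegral_mul _ ht hFs,
    lintegral_withDensity_eq_lintegral_mul _ (measurable_outputDensity p).ennreal_ofReal hF,
    lintegral_prod_symm _ (ht.mul hFs).aemeasurable]
  refine lintegral_congr fun y => ?_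
  rw [lintegral_zmod_two]
  simp only [Pi.mul_apply, outputDensity]
  rw [ENNReal.ofReal_sum_of_nonneg fun x _ => mul_nonneg measureReal_nonneg (transition_nonneg _ _),
    Finset.sum_mul]
  refine Finset.sum_congr rfl fun x _ => ?_
  rw [ENNReal.ofReal_mul measureReal_nonneg, mul_assoc]

theorem measureReal_zero_add_one : p.real {0} + p.real {1} = 1 := by
  have h := sum_measureReal_singleton (Finset.univ : Finset (ZMod 2)) (μ := p)
  rw [sum_zmod_two] at h
  rw [h]; simp

/-- For a fixed crossover probability the left-hand side is the entropy of the received bit minus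
that of the noise, and a bit has entropy at most `log 2`. -/
theorem sum_mul_klFun_le (e : Crossover) :
    ∑ u, ∑ x, p.real {x} * (outputDensity p (e, u) *
      InformationTheory.klFun (transition x (e, u) / outputDensity p (e, u))) ≤
      Real.log 2 - Real.binEntropy e := by
  have hp := measureReal_zero_add_one p
  have key : ∀ u x, p.real {x} * (outputDensity p (e, u) *
      InformationTheory.klFun (transition x (e, u) / outputDensity p (e, u))) =
      p.real {x} * (transition x (e, u) * Real.log (transition x (e, u)))
        - p.real {x} * transition x (e, u) * Real.log (outputDensity p (e, u))
        + p.real {x} * outputDensity p (e, u) - p.real {x} * transition x (e, u) := by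
    intro u x
    -- If the output density vanishes, so does every `p.real {x} * transition x (e, u)`, and both
    -- sides are 0.
    rcases eq_or_lt_of_le (outputDensity_nonneg p (e, u)) with h | h
    · have h1 : p.real {x} * transition x (e, u) = 0 := by
        have := (Finset.sum_eq_zero_iff_of_nonneg (s := Finset.univ)
          (f := fun x => p.real {x} * transition x (e, u)) fun x _ =>
          mul_nonneg measureReal_nonneg (transition_nonneg _ _)).1 h.symm x (Finset.mem_univ x)
        exact this
      rw [← h, ← mul_assoc (p.real {x}) (transition x (e, u)), h1]
      simp
    · rcases eq_or_lt_of_le (transition_nonneg x (e, u)) with h' | h'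
      · simp [← h', InformationTheory.klFun]
      · rw [InformationTheory.klFun, Real.log_div h'.ne' h.ne']
        field_simp
  simp only [key, sum_zmod_two]
  have hs : outputDensity p (e, 1) = 1 - outputDensity p (e, 0) := by
    simp only [outputDensity, sum_zmod_two, transition]
    simp
    linear_combination hp
  have hb := Real.binEntropy_le_log_two (p := outputDensity p (e, 0))
  rw [Real.binEntropy_eq_negMulLog_add_negMulLog_one_sub, Real.negMulLog, Real.negMulLog,
    ← hs] at hb
  rw [Real.binEntropy_eq_negMulLog_add_negMulLog_one_sub, Real.negMulLog, Real.negMulLog]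
  have e0 : outputDensity p (e, 0) = p.real {0} * (1 - e) + p.real {1} * e := by
    simp [outputDensity, sum_zmod_two, transition]
  have e1 : outputDensity p (e, 1) = p.real {0} * e + p.real {1} * (1 - e) := by
    simp [outputDensity, sum_zmod_two, transition]
  generalize outputDensity p (e, 0) = s0 at *
  generalize outputDensity p (e, 1) = s1 at *
  generalize Real.log s0 = l0 at *
  generalize Real.log s1 = l1 at *
  simp only [transition]
  simp
  generalize Real.log e = le at *
  generalize Real.log (1 - e) = le' at *
  have hp1 : p.real {1} = 1 - p.real {0} := by linarith
  subst e0 e1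
  rw [hp1] at *
  linarith

theorem integrable_binEntropy :
    Integrable (fun e : Crossover => Real.binEntropy (e : ℝ)) ν := by
  refine Continuous.integrable_of_hasCompactSupport ?_ (HasCompactSupport.of_compactSpace _)
  have := Real.binEntropy_continuous
  fun_prop

/-- The joint law has density transition over output density with respect to the product of its
marginals; the pointwise bound is then averaged over the crossover probability. -/
theorem klDiv_inputOutputLaw_le :
    InformationTheory.klDiv (inputOutputLaw ν p)
      ((inputOutputLaw ν p).fst.prod (inputOutputLaw ν p).snd) ≤
    ENNReal.ofReal (Real.log 2 - ∫ e, Real.binEntropy (e : ℝ) ∂ν) := by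
  set s : ChannelSymbol → ℝ≥0∞ := fun y => ENNReal.ofReal (outputDensity p y) with hs
  have hsm : Measurable s := (measurable_outputDensity p).ennreal_ofReal
  have hsm' : Measurable fun q : ZMod 2 × ChannelSymbol => s q.2 := hsm.comp measurable_snd
  set ρ : ZMod 2 × ChannelSymbol → ℝ≥0∞ :=
    fun q => ENNReal.ofReal (transition q.1 q.2) / s q.2 with hρ
  have hρm : Measurable ρ := measurable_transition.ennreal_ofReal.div hsm'
  have hprod : (inputOutputLaw ν p).fst.prod (inputOutputLaw ν p).snd =
      (p.prod (ν.prod Measure.count)).withDensity fun q => s q.2 := by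
    rw [fst_inputOutputLaw, snd_inputOutputLaw, prod_withDensity_right hsm]
  have hdens : inputOutputLaw ν p =
      ((inputOutputLaw ν p).fst.prod (inputOutputLaw ν p).snd).withDensity ρ := by
    rw [hprod, ← withDensity_mul _ hsm' hρm]
    conv_lhs => rw [inputOutputLaw_eq_withDensity]
    refine withDensity_congr_ae ?_
    -- Inputs of probability 0 must be discarded: for the others, a vanishing output density forces
    -- a vanishing transition probability, so the quotient is harmless.
    have h1 : ∀ᵐ x ∂p, p {x} ≠ 0 := by rw [ae_iff_of_countable]; exact fun x hx => hx
    have h2 := (Measure.quasiMeasurePreserving_fst (μ := p)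
      (ν := ν.prod (Measure.count (α := ZMod 2)))).ae h1
    filter_upwards [h2] with q hq
    simp only [Pi.mul_apply, hρ]
    by_cases h0 : s q.2 = 0
    · have h3 : outputDensity p q.2 = 0 :=
        le_antisymm (ENNReal.ofReal_eq_zero.1 h0) (outputDensity_nonneg p _)
      have h4 := (Finset.sum_eq_zero_iff_of_nonneg (s := Finset.univ)
          (f := fun x => p.real {x} * transition x q.2) fun x _ =>
          mul_nonneg measureReal_nonneg (transition_nonneg _ _)).1 h3 q.1 (Finset.mem_univ _)
      have h5 : p.real {q.1} ≠ 0 := by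
        rw [Measure.real, ENNReal.toReal_ne_zero]
        exact ⟨hq, measure_ne_top _ _⟩
      have h6 : transition q.1 q.2 = 0 := (mul_eq_zero.1 h4).resolve_left h5
      simp [h6]
    · exact (ENNReal.mul_div_cancel h0 ENNReal.ofReal_ne_top).symm
  have hac : inputOutputLaw ν p ≪ (inputOutputLaw ν p).fst.prod (inputOutputLaw ν p).snd := by
    conv_lhs => rw [hdens]
    exact withDensity_absolutelyContinuous _ _
  rw [InformationTheory.klDiv_eq_lintegral_klFun_of_ac hac]
  have hrn : (inputOutputLaw ν p).rnDeriv
      ((inputOutputLaw ν p).fst.prod (inputOutputLaw ν p).snd) =ᵐ[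
      (inputOutputLaw ν p).fst.prod (inputOutputLaw ν p).snd] ρ := by
    have := Measure.rnDeriv_withDensity
      ((inputOutputLaw ν p).fst.prod (inputOutputLaw ν p).snd) hρm
    rwa [← hdens] at this
  have hkm : Measurable fun q => ENNReal.ofReal (InformationTheory.klFun (ρ q).toReal) :=
    (InformationTheory.measurable_klFun.comp hρm.ennreal_toReal).ennreal_ofReal
  calc ∫⁻ q, ENNReal.ofReal (InformationTheory.klFun ((inputOutputLaw ν p).rnDeriv
          ((inputOutputLaw ν p).fst.prod (inputOutputLaw ν p).snd) q).toReal)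
          ∂((inputOutputLaw ν p).fst.prod (inputOutputLaw ν p).snd)
      = ∫⁻ q, ENNReal.ofReal (InformationTheory.klFun (ρ q).toReal)
          ∂((inputOutputLaw ν p).fst.prod (inputOutputLaw ν p).snd) :=
        lintegral_congr_ae (hrn.mono fun q hq => by simp only [hq])
    _ = ∫⁻ y, ∑ x, ENNReal.ofReal (p.real {x}) *
          (s y * ENNReal.ofReal (InformationTheory.klFun (ρ (x, y)).toReal))
          ∂(ν.prod Measure.count) := by
        rw [hprod, lintegral_withDensity_eq_lintegral_mul _ hsm' hkm,
          lintegral_prod_symm _ (hsm'.mul hkm).aemeasurable]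
        refine lintegral_congr fun y => ?_
        rw [lintegral_zmod_two]
        rfl
    _ = ∫⁻ e, ENNReal.ofReal (∑ u, ∑ x, p.real {x} * (outputDensity p (e, u) *
          InformationTheory.klFun (transition x (e, u) / outputDensity p (e, u)))) ∂ν := by
        have hkx : ∀ x, Measurable fun y =>
            ENNReal.ofReal (InformationTheory.klFun (ρ (x, y)).toReal) := fun x =>
          hkm.comp measurable_prodMk_left
        have hm : Measurable fun y => ∑ x, ENNReal.ofReal (p.real {x}) *
            (s y * ENNReal.ofReal (InformationTheory.klFun (ρ (x, y)).toReal)) :=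
          Finset.measurable_sum _ fun x _ => (hsm.mul (hkx x)).const_mul _
        rw [lintegral_prod_count _ hm]
        refine lintegral_congr fun e => ?_
        have hnn : ∀ u x, 0 ≤ outputDensity p (e, u) *
            InformationTheory.klFun (transition x (e, u) / outputDensity p (e, u)) := fun u x =>
          mul_nonneg (outputDensity_nonneg p _) (InformationTheory.klFun_nonneg
            (div_nonneg (transition_nonneg _ _) (outputDensity_nonneg p _)))
        rw [ENNReal.ofReal_sum_of_nonneg fun u _ => Finset.sum_nonneg fun x _ =>
          mul_nonneg measureReal_nonneg (hnn u x)]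
        refine Finset.sum_congr rfl fun u _ => ?_
        rw [ENNReal.ofReal_sum_of_nonneg fun x _ => mul_nonneg measureReal_nonneg (hnn u x)]
        refine Finset.sum_congr rfl fun x _ => ?_
        rw [ENNReal.ofReal_mul measureReal_nonneg, ENNReal.ofReal_mul (outputDensity_nonneg p _)]
        simp only [hρ, hs, ENNReal.toReal_div,
          ENNReal.toReal_ofReal (transition_nonneg _ _),
          ENNReal.toReal_ofReal (outputDensity_nonneg p _)]
    _ ≤ ∫⁻ e, ENNReal.ofReal (Real.log 2 - Real.binEntropy (e : ℝ)) ∂ν :=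
        lintegral_mono fun e => ENNReal.ofReal_le_ofReal (sum_mul_klFun_le p e)
    _ = ENNReal.ofReal (∫ e : Crossover, (Real.log 2 - Real.binEntropy (e : ℝ)) ∂ν) := by
        rw [ofReal_integral_eq_lintegral_ofReal]
        · exact (integrable_const _).sub (integrable_binEntropy ν)
        · exact ae_of_all _ fun e => sub_nonneg.2 Real.binEntropy_le_log_two
    _ = _ := by
        rw [integral_sub (integrable_const _) (integrable_binEntropy ν)]
        simp

/-- Only this upper bound on the capacity is needed, as the capacity enters the theorem through a
rate below it. The optimality of uniform input plays no role. -/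
theorem capacity_mul_log_two_le :
    capacity ν * Real.log 2 ≤ Real.log 2 - ∫ e, Real.binEntropy (e : ℝ) ∂ν := by
  rw [capacity, div_mul_cancel₀ _ (Real.log_pos one_lt_two).ne']
  have hint : ∫ e : Crossover, Real.binEntropy (e : ℝ) ∂ν ≤ Real.log 2 := by
    refine (integral_mono_of_nonneg (ae_of_all _ fun e => ?_) (integrable_const (Real.log 2))
      (ae_of_all _ fun e => Real.binEntropy_le_log_two)).trans (by simp)
    exact Real.binEntropy_nonneg e.2.1 (by linarith [e.2.2])
  refine ENNReal.toReal_le_of_le_ofReal (by linarith) (iSup_le fun q => ?_)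
  exact klDiv_inputOutputLaw_le ν q

end Capacity

/-! ### Reed–Muller codes -/

section ReedMuller

theorem mem_reedMuller {m r : ℕ} {c : (Fin m → ZMod 2) → ZMod 2} :
    c ∈ reedMuller m r ↔ ∃ P : MvPolynomial (Fin m) (ZMod 2), P.totalDegree ≤ r ∧
      ∀ v, MvPolynomial.eval v P = c v := by
  simp only [reedMuller, Submodule.mem_map, MvPolynomial.mem_restrictTotalDegree]
  refine exists_congr fun P => and_congr_right fun _ => ?_
  exact funext_iff

theorem totalDegree_aeval_le {σ τ R : Type*} [CommSemiring R]
    (L : σ → MvPolynomial τ R) (hL : ∀ i, (L i).totalDegree ≤ 1) (P : MvPolynomial σ R) :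
    (MvPolynomial.aeval L P).totalDegree ≤ P.totalDegree := by
  rw [MvPolynomial.aeval_def, MvPolynomial.eval₂_eq]
  refine MvPolynomial.totalDegree_finsetSum_le fun d hd => ?_
  refine (MvPolynomial.totalDegree_mul _ _).trans ?_
  rw [MvPolynomial.algebraMap_eq, MvPolynomial.totalDegree_C, zero_add]
  refine (MvPolynomial.totalDegree_finsetProd _ _).trans
    (le_trans (Finset.sum_le_sum fun i _ => ?_) (MvPolynomial.le_totalDegree hd))
  refine (MvPolynomial.totalDegree_pow _ _).trans ?_
  simpa using Nat.mul_le_mul_left (d i) (hL i)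

/-- Reed–Muller codes are preserved by affine substitutions. -/
theorem comp_affine_mem_reedMuller {m m' r : ℕ} {c : (Fin m → ZMod 2) → ZMod 2}
    (hc : c ∈ reedMuller m r) (T : (Fin m' → ZMod 2) →ₗ[ZMod 2] (Fin m → ZMod 2))
    (b : Fin m → ZMod 2) : (fun v => c (T v + b)) ∈ reedMuller m' r := by
  obtain ⟨P, hP, hPc⟩ := mem_reedMuller.1 hc
  set L : Fin m → MvPolynomial (Fin m') (ZMod 2) := fun i =>
    ∑ k, MvPolynomial.C (T (Pi.single k 1) i) * MvPolynomial.X k + MvPolynomial.C (b i) with hLdef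
  have hL : ∀ i, (L i).totalDegree ≤ 1 := by
    intro i
    refine (MvPolynomial.totalDegree_add _ _).trans (max_le ?_ (by simp))
    refine MvPolynomial.totalDegree_finsetSum_le fun k _ => ?_
    refine (MvPolynomial.totalDegree_mul _ _).trans ?_
    simp
  have hLe : ∀ v i, MvPolynomial.eval v (L i) = (T v + b) i := by
    intro v i
    have hv : T v = ∑ k, v k • T (Pi.single k 1) := by
      conv_lhs => rw [← Finset.univ_sum_single v, map_sum]
      refine Finset.sum_congr rfl fun k _ => ?_
      rw [← map_smul]
      congr 1
      ext l
      simp [Pi.single_apply]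
    simp [hLdef, hv, mul_comm]
  refine mem_reedMuller.2 ⟨MvPolynomial.aeval L P, (totalDegree_aeval_le L hL P).trans hP,
    fun v => ?_⟩
  rw [← hPc, MvPolynomial.aeval_def, MvPolynomial.eval₂_eq, MvPolynomial.eval_eq (T v + b)]
  simp [map_sum, map_prod, hLe]

/-- The exponents of the squarefree monomials of degree at most `r`. -/
def squarefreeExponents (m r : ℕ) : Set (Fin m →₀ ℕ) :=
  {d | (∀ i, d i ≤ 1) ∧ d.support.card ≤ r}

/-- Squarefree monomials correspond to sets of variables. -/
noncomputable def squarefreeExponentsEquiv (m r : ℕ) :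
    squarefreeExponents m r ≃ {s : Finset (Fin m) // s.card ≤ r} where
  toFun d := ⟨d.1.support, d.2.2⟩
  invFun s := ⟨Finsupp.indicator s.1 fun _ _ => 1, by
    refine ⟨fun i => ?_, (Finset.card_le_card (Finsupp.support_indicator_subset _ _)).trans s.2⟩
    rw [Finsupp.indicator_apply]
    split_ifs <;> simp⟩
  left_inv d := by
    ext i
    have := d.2.1 i
    simp only [Finsupp.indicator_apply, Finsupp.mem_support_iff]
    split_ifs <;> omega
  right_inv s := by
    ext i
    simp [Finsupp.indicator_apply]

theorem natCard_squarefreeExponents (m r : ℕ) :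
    Nat.card (squarefreeExponents m r) = ∑ i ∈ Finset.range (r + 1), m.choose i := by
  rw [Nat.card_congr (squarefreeExponentsEquiv m r), Nat.card_eq_fintype_card,
    Fintype.card_subtype, Finset.card_eq_sum_card_fiberwise (f := Finset.card)
      (t := Finset.range (r + 1)) (fun s hs => by simpa [Nat.lt_succ_iff] using hs)]
  refine Finset.sum_congr rfl fun i hi => ?_
  have : (Finset.univ.filter fun s : Finset (Fin m) => s.card ≤ r).filter (fun s => s.card = i) =
      Finset.powersetCard i Finset.univ := by
    ext s
    simp only [Finset.mem_filter, Finset.mem_univ, true_and, Finset.mem_powersetCard,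
      Finset.subset_univ]
    have := Finset.mem_range.1 hi
    constructor
    · exact fun h => h.2
    · exact fun h => ⟨by omega, h⟩
  rw [this, Finset.card_powersetCard, Finset.card_univ, Fintype.card_fin]

/-- On 𝔽₂ every positive power of a variable equals the variable, so a monomial has the same values
as the product of the variables in its support. -/
theorem reedMuller_eq_map_squarefree (m r : ℕ) : reedMuller m r =
    (MvPolynomial.restrictSupport (ZMod 2) (squarefreeExponents m r)).map
      (MvPolynomial.evalₗ (ZMod 2) (Fin m)) := by
  have hcard : ∀ d : Fin m →₀ ℕ, d.support.card ≤ d.sum fun _ e => e := fun d => by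
    rw [Finsupp.sum, Finset.card_eq_sum_ones]
    exact Finset.sum_le_sum fun i hi => Nat.one_le_iff_ne_zero.2 (Finsupp.mem_support_iff.1 hi)
  apply le_antisymm
  · rw [reedMuller, MvPolynomial.restrictTotalDegree, MvPolynomial.restrictSupport_eq_span,
      Submodule.map_span, Submodule.span_le]
    rintro _ ⟨_, ⟨d, hd, rfl⟩, rfl⟩
    have hd' : d.support.card ≤ r := (hcard d).trans hd
    refine ⟨MvPolynomial.monomial ((squarefreeExponentsEquiv m r).symm ⟨d.support, hd'⟩).1 1,
      (MvPolynomial.monomial_mem_restrictSupport _).2 (Or.inl (Subtype.coe_prop _)), ?_⟩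
    ext v
    simp only [MvPolynomial.evalₗ_apply, MvPolynomial.eval_monomial, one_mul]
    rw [Finsupp.prod_fintype _ _ (by simp), Finsupp.prod_fintype _ _ (by simp)]
    refine Finset.prod_congr rfl fun i _ => ?_
    have hx : v i = 0 ∨ v i = 1 := by generalize v i = x; revert x; decide
    rcases hx with h | h <;>
      simp [h, squarefreeExponentsEquiv, Finsupp.indicator_apply, zero_pow_eq]
  · rw [reedMuller]
    refine Submodule.map_mono (MvPolynomial.restrictSupport_mono _ fun d hd => ?_)
    refine le_trans (Finset.sum_le_card_nsmul _ _ 1 fun i _ => hd.1 i) ?_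
    simpa using hd.2

/-- A polynomial over 𝔽₂ of degree at most 1 in each variable is determined by its values, so the
squarefree monomials form a basis. -/
theorem finrank_reedMuller (m r : ℕ) :
    Module.finrank (ZMod 2) (reedMuller m r) = ∑ i ∈ Finset.range (r + 1), m.choose i := by
  rw [reedMuller_eq_map_squarefree, ← LinearMap.range_domRestrict, LinearMap.finrank_range_of_inj,
    Module.finrank_eq_nat_card_basis (MvPolynomial.basisRestrictSupport _ _),
    natCard_squarefreeExponents]
  rw [← LinearMap.ker_eq_bot, LinearMap.ker_eq_bot']
  intro P hP
  refine Subtype.ext (MvPolynomial.eq_zero_of_eval_eq_zero _ _ P.1 (fun v => congr_fun hP v) ?_)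
  exact MvPolynomial.restrictSupport_mono _ (fun d hd i => by simpa using hd.1 i) P.2

/-! ### The loss of rate under shortening -/

/-- Induction through the recurrence for central binomial coefficients; the step is `(2n + 1)(2n +
3) ≤ 4(n + 1)²`. -/
theorem centralBinom_sq_mul_le (n : ℕ) : n.centralBinom ^ 2 * (2 * n + 1) ≤ 16 ^ n := by
  induction n with
  | zero => simp
  | succ n ih =>
    have h := Nat.succ_mul_centralBinom_succ n
    have hpos : 0 < (n + 1) ^ 2 := by positivity
    refine Nat.le_of_mul_le_mul_left ?_ hpos
    calc (n + 1) ^ 2 * ((n + 1).centralBinom ^ 2 * (2 * (n + 1) + 1))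
        = ((n + 1) * (n + 1).centralBinom) ^ 2 * (2 * n + 3) := by ring
      _ = (n.centralBinom ^ 2 * (2 * n + 1)) * (4 * ((2 * n + 1) * (2 * n + 3))) := by
          rw [h]; ring
      _ ≤ 16 ^ n * (4 * (4 * (n + 1) ^ 2)) := by
          refine Nat.mul_le_mul ih (Nat.mul_le_mul_left 4 ?_)
          nlinarith
      _ = (n + 1) ^ 2 * 16 ^ (n + 1) := by ring

theorem choose_two_mul_mul_sqrt_le (n r : ℕ) :
    ((2 * n).choose r : ℝ) * √(2 * n + 1 : ℝ) ≤ 4 ^ n := by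
  have h1 : ((2 * n).choose r : ℝ) ≤ n.centralBinom := by
    exact_mod_cast Nat.choose_le_centralBinom r n
  have h2 : (n.centralBinom : ℝ) ^ 2 * (2 * n + 1) ≤ 16 ^ n := by
    exact_mod_cast centralBinom_sq_mul_le n
  refine (mul_le_mul_of_nonneg_right h1 (Real.sqrt_nonneg _)).trans ?_
  refine abs_le_of_sq_le_sq' ?_ (by positivity) |>.2
  rw [mul_pow, Real.sq_sqrt (by positivity), ← pow_mul, mul_comm n 2, pow_mul]
  norm_num
  exact h2

/-- Even `m` is the central binomial estimate; odd `m` follows from it by Pascal's rule. -/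
theorem choose_mul_sqrt_le (m r : ℕ) : (m.choose r : ℝ) * √m ≤ 2 ^ m := by
  obtain ⟨n, rfl | rfl⟩ := Nat.even_or_odd' m
  · have h := choose_two_mul_mul_sqrt_le n r
    rw [pow_mul, show (2 : ℝ) ^ 2 = 4 by norm_num]
    refine le_trans (mul_le_mul_of_nonneg_left (Real.sqrt_le_sqrt ?_) (Nat.cast_nonneg _)) h
    push_cast
    linarith
  · have key : ((2 * n + 1).choose r : ℝ) * √(2 * n + 1 : ℝ) ≤ 2 * 4 ^ n := by
      cases r with
      | zero =>
        have h := choose_two_mul_mul_sqrt_le n 0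
        have : (0 : ℝ) ≤ 4 ^ n := by positivity
        simp only [Nat.choose_zero_right] at h ⊢
        linarith
      | succ r =>
        have h1 := choose_two_mul_mul_sqrt_le n r
        have h2 := choose_two_mul_mul_sqrt_le n (r + 1)
        rw [Nat.choose_succ_succ]
        push_cast
        linarith
    rw [pow_succ, pow_mul]
    push_cast
    norm_num
    linarith

theorem codeRate_reedMuller (m r : ℕ) :
    codeRate (reedMuller m r) = (∑ i ∈ Finset.range (r + 1), (m.choose i : ℝ)) / 2 ^ m := by
  rw [codeRate, finrank_reedMuller]
  simp

/-- Pascal's rule, summed up to `r`, doubles the sum of binomial coefficients except for the last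
term. -/
theorem codeRate_reedMuller_succ (m r : ℕ) :
    codeRate (reedMuller m r) = codeRate (reedMuller (m + 1) r) + m.choose r / 2 ^ (m + 1) := by
  have h : ∑ i ∈ Finset.range (r + 1), ((m + 1).choose i : ℝ) + m.choose r =
      2 * ∑ i ∈ Finset.range (r + 1), (m.choose i : ℝ) := by
    rw [Finset.sum_range_succ', Finset.sum_congr rfl fun i _ => by
      rw [Nat.choose_succ_succ, Nat.cast_add], Finset.sum_add_distrib]
    have h1 := Finset.sum_range_succ (fun i => (m.choose i : ℝ)) r
    have h2 := Finset.sum_range_succ' (fun i => (m.choose i : ℝ)) r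
    simp only [Nat.choose_zero_right] at h2 ⊢
    linarith
  rw [codeRate_reedMuller, codeRate_reedMuller, ← add_div, h, pow_succ]
  field_simp

/-- Shortening the block length of a Reed–Muller code by a factor `2 ^ l` raises its rate by at most
`l / √m`. -/
theorem codeRate_reedMuller_sub_le {m l : ℕ} (r : ℕ) (hl : 2 * l ≤ m) (hm : 0 < m) :
    codeRate (reedMuller (m - l) r) ≤ codeRate (reedMuller m r) + l / √m := by
  have hsm : 0 < √(m : ℝ) := Real.sqrt_pos.2 (by exact_mod_cast hm)
  induction l with
  | zero => simp
  | succ l ih =>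
    have h1 := codeRate_reedMuller_succ (m - (l + 1)) r
    rw [show m - (l + 1) + 1 = m - l by omega] at h1
    set n := m - (l + 1) with hn
    have h2 := choose_mul_sqrt_le n r
    -- The factor 2 is absorbed by the denominator `2 ^ (m - l) = 2 * 2 ^ n`.
    have h3 : √(m : ℝ) ≤ 2 * √(n : ℝ) := by
      rw [show (2 : ℝ) = √4 by rw [show (4 : ℝ) = 2 ^ 2 by norm_num]; simp,
        ← Real.sqrt_mul (by norm_num)]
      refine Real.sqrt_le_sqrt ?_
      have : m ≤ 4 * n := by omega
      exact_mod_cast this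
    have h4 : (n.choose r : ℝ) / 2 ^ (m - l) ≤ 1 / √m := by
      rw [div_le_div_iff₀ (by positivity) hsm, show m - l = n + 1 by omega, pow_succ]
      have : (n.choose r : ℝ) * √m ≤ n.choose r * (2 * √n) := by gcongr
      linarith
    have h5 := ih (by omega)
    push_cast
    rw [add_div]
    linarith

end ReedMuller

/-! ### Transmission of codewords -/

section Transmission

open scoped ENNReal

set_option linter.unusedSectionVars false

variable {ι : Type} [Fintype ι]

/-- The output of the memoryless channel on input `c` under the noise `z`. -/
def wordOutput (c : ι → ZMod 2) (z : ι → ChannelSymbol) : ι → ChannelSymbol :=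
  fun j => channelOutput (c j) (z j)

/-- The likelihood of the word `c` given the output `y`. -/
noncomputable def wordLikelihood (c : ι → ZMod 2) (y : ι → ChannelSymbol) : ℝ :=
  ∏ j, transition (c j) (y j)

/-- The output with crossover probabilities `e` and received bits `u`. -/
def outputOf (e : ι → Crossover) (u : ι → ZMod 2) : ι → ChannelSymbol := fun j => (e j, u j)

theorem measurable_wordOutput (c : ι → ZMod 2) : Measurable (wordOutput c) :=
  measurable_pi_lambda _ fun j =>
    (measurable_channelOutput_right (c j)).comp (measurable_pi_apply j)

theorem measurable_wordLikelihood (c : ι → ZMod 2) : Measurable (wordLikelihood c) :=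
  Finset.measurable_prod _ fun j _ =>
    (measurable_transition_right (c j)).comp (measurable_pi_apply j)

theorem wordLikelihood_nonneg (c : ι → ZMod 2) (y : ι → ChannelSymbol) : 0 ≤ wordLikelihood c y :=
  Finset.prod_nonneg fun _ _ => transition_nonneg _ _

theorem wordLikelihood_le_one (c : ι → ZMod 2) (y : ι → ChannelSymbol) : wordLikelihood c y ≤ 1 :=
  Finset.prod_le_one (fun _ _ => transition_nonneg _ _) fun _ _ => transition_le_one _ _

theorem isBddMeasurable_wordLikelihood (c : ι → ZMod 2) : IsBddMeasurable (wordLikelihood c) :=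
  ⟨measurable_wordLikelihood c, 1, fun y => by
    rw [abs_of_nonneg (wordLikelihood_nonneg c y)]; exact wordLikelihood_le_one c y⟩

theorem measurable_outputOf (u : ι → ZMod 2) :
    Measurable fun e : ι → Crossover => outputOf e u :=
  measurable_pi_lambda _ fun j => (measurable_pi_apply j).prodMk measurable_const

variable (ν : Measure Crossover) [IsProbabilityMeasure ν]

theorem lintegral_pi_prod (G : ι → Crossover → ℝ≥0∞) (hG : ∀ j, Measurable (G j)) :
    ∫⁻ e, ∏ j, G j (e j) ∂(Measure.pi fun _ => ν) = ∏ j, ∫⁻ x, G j x ∂ν := by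
  have hind := ProbabilityTheory.iIndepFun_pi (μ := fun _ : ι => ν) (X := G)
    fun j => (hG j).aemeasurable
  rw [ProbabilityTheory.lintegral_prod_eq_prod_lintegral_of_indepFun Finset.univ
    (fun j (e : ι → Crossover) => G j (e j)) hind
    fun j => (hG j).comp (measurable_pi_apply j)]
  refine Finset.prod_congr rfl fun j _ => ?_
  exact (measurePreserving_eval (fun _ : ι => ν) j).lintegral_comp (hG j)

/-- Separates the crossover probabilities from the received bits, so that the inequality on the cube
can be applied for each fixed `e`. On boxes the identity is the expansion of a product of sums. -/
theorem map_wordOutput [DecidableEq ι] (c : ι → ZMod 2) :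
    (Measure.pi fun _ => noiseLaw ν).map (wordOutput c) =
      ∑ u : ι → ZMod 2, ((Measure.pi fun _ => ν).withDensity fun e =>
        ENNReal.ofReal (wordLikelihood c (outputOf e u))).map fun e => outputOf e u := by
  have h1 : (Measure.pi fun _ => noiseLaw ν).map (wordOutput c) =
      Measure.pi fun j => (noiseLaw ν).map (channelOutput (c j)) := by
    have : ∀ j, IsProbabilityMeasure ((noiseLaw ν).map (channelOutput (c j))) := fun j =>
      Measure.isProbabilityMeasure_map (measurable_channelOutput_right (c j)).aemeasurable
    exact Measure.pi_map_pi fun j => (measurable_channelOutput_right (c j)).aemeasurable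
  rw [h1]
  have : ∀ j, IsProbabilityMeasure ((noiseLaw ν).map (channelOutput (c j))) := fun j =>
    Measure.isProbabilityMeasure_map (measurable_channelOutput_right (c j)).aemeasurable
  refine Measure.pi_eq fun s hs => ?_
  set G : ι → ZMod 2 → Crossover → ℝ≥0∞ := fun j v x =>
    (s j).indicator (fun y => ENNReal.ofReal (transition (c j) y)) (x, v) with hG
  have hind : ∀ j, Measurable
      ((s j).indicator fun y => ENNReal.ofReal (transition (c j) y)) := fun j =>
    (measurable_transition_right (c j)).ennreal_ofReal.indicator (hs j)
  have hGm : ∀ j v, Measurable (G j v) := fun j v => (hind j).comp measurable_prodMk_right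
  have hbox : MeasurableSet (Set.univ.pi s) := MeasurableSet.univ_pi hs
  rw [Measure.finsetSum_apply]
  calc ∑ u : ι → ZMod 2, (((Measure.pi fun _ => ν).withDensity fun e =>
        ENNReal.ofReal (wordLikelihood c (outputOf e u))).map fun e => outputOf e u)
          (Set.univ.pi s)
      = ∑ u : ι → ZMod 2, ∫⁻ e, ∏ j, G j (u j) (e j) ∂(Measure.pi fun _ => ν) := by
        refine Finset.sum_congr rfl fun u _ => ?_
        have hpre : MeasurableSet ((fun e : ι → Crossover => outputOf e u) ⁻¹' Set.univ.pi s) :=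
          measurable_outputOf u hbox
        rw [Measure.map_apply (measurable_outputOf u) hbox, withDensity_apply _ hpre,
          ← lintegral_indicator hpre]
        refine lintegral_congr fun e => ?_
        by_cases he : ∀ j, (e j, u j) ∈ s j
        · rw [Set.indicator_of_mem (by simpa [outputOf] using he), wordLikelihood,
            ENNReal.ofReal_prod_of_nonneg fun j _ => transition_nonneg _ _]
          refine Finset.prod_congr rfl fun j _ => ?_
          simp only [hG, Set.indicator_of_mem (he j)]
          rfl
        · rw [Set.indicator_of_notMem (by simpa [outputOf] using he)]
          push Not at he
          obtain ⟨j, hj⟩ := he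
          refine (Finset.prod_eq_zero (Finset.mem_univ j) ?_).symm
          simp only [hG, Set.indicator_of_notMem hj]
    _ = ∑ u : ι → ZMod 2, ∏ j, ∫⁻ x, G j (u j) x ∂ν :=
        Finset.sum_congr rfl fun u _ => lintegral_pi_prod ν _ fun j => hGm j (u j)
    _ = ∏ j, ∑ v, ∫⁻ x, G j v x ∂ν := by
        rw [Finset.prod_univ_sum, Fintype.piFinset_univ]
    _ = ∏ j, (noiseLaw ν).map (channelOutput (c j)) (s j) := by
        refine Finset.prod_congr rfl fun j _ => ?_
        rw [map_channelOutput, withDensity_apply _ (hs j), ← lintegral_indicator (hs j),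
          lintegral_prod_count ν (hind j), lintegral_finsetSum _ fun v _ => hGm j v]

/-- The expectation of a function of the channel output on input `c`. -/
theorem integral_wordOutput [DecidableEq ι] (c : ι → ZMod 2) {F : (ι → ChannelSymbol) → ℝ}
    (hF : IsBddMeasurable F) :
    ∫ z, F (wordOutput c z) ∂(Measure.pi fun _ => noiseLaw ν) =
      ∫ e, ∑ u, wordLikelihood c (outputOf e u) * F (outputOf e u) ∂(Measure.pi fun _ => ν) := by
  have hm : ∀ u : ι → ZMod 2, Measurable fun e : ι → Crossover =>
      ENNReal.ofReal (wordLikelihood c (outputOf e u)) := fun u =>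
    ((measurable_wordLikelihood c).comp (measurable_outputOf u)).ennreal_ofReal
  have hb : ∀ u : ι → ZMod 2, IsBddMeasurable fun e : ι → Crossover =>
      wordLikelihood c (outputOf e u) * F (outputOf e u) := fun u =>
    ((isBddMeasurable_wordLikelihood c).mul hF).comp (measurable_outputOf u)
  have key : ∀ u : ι → ZMod 2, ∀ e : ι → Crossover,
      (ENNReal.ofReal (wordLikelihood c (outputOf e u))).toReal • F (outputOf e u) =
        wordLikelihood c (outputOf e u) * F (outputOf e u) := fun u e => by
    rw [ENNReal.toReal_ofReal (wordLikelihood_nonneg _ _), smul_eq_mul]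
  have hmap := integral_map (μ := Measure.pi fun _ : ι => noiseLaw ν)
    (measurable_wordOutput c).aemeasurable hF.1.aestronglyMeasurable
  rw [← hmap, map_wordOutput, integral_finsetSum_measure, integral_finsetSum _
    fun u _ => (hb u).integrable _]
  · refine Finset.sum_congr rfl fun u _ => ?_
    rw [integral_map (measurable_outputOf u).aemeasurable hF.1.aestronglyMeasurable,
      integral_withDensity_eq_integral_toReal_smul (hm u)
        (ae_of_all _ fun _ => ENNReal.ofReal_lt_top)]
    simp only [key]
  · intro u _
    rw [integrable_map_measure hF.1.aestronglyMeasurable (measurable_outputOf u).aemeasurable,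
      integrable_withDensity_iff_integrable_smul' (hm u)
        (ae_of_all _ fun _ => ENNReal.ofReal_lt_top)]
    simp only [Function.comp, key]
    exact (hb u).integrable _

open scoped Classical in
/-- The codewords of a code. -/
noncomputable def codewords (C : Submodule (ZMod 2) (ι → ZMod 2)) : Finset (ι → ZMod 2) :=
  Finset.univ.filter (· ∈ C)

theorem mem_codewords {C : Submodule (ZMod 2) (ι → ZMod 2)} {c : ι → ZMod 2} :
    c ∈ codewords C ↔ c ∈ C := by simp [codewords]

theorem card_codewords (C : Submodule (ZMod 2) (ι → ZMod 2)) :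
    (codewords C).card = 2 ^ Module.finrank (ZMod 2) C := by
  classical
  rw [codewords, ← Fintype.card_subtype]
  have := Module.card_eq_pow_finrank (K := ZMod 2) (V := C)
  rw [ZMod.card] at this
  rw [← this]

/-- The likelihood of `X_i = b`, where only the output coordinates in `s` are observed. -/
noncomputable def partialLikelihood (C : Submodule (ZMod 2) (ι → ZMod 2)) (s : Finset ι) (i : ι)
    (b : ZMod 2) (y : ι → ChannelSymbol) : ℝ :=
  ∑ c ∈ codewords C with c i = b, ∏ j ∈ s, transition (c j) (y j)

theorem bitLikelihood_eq (C : Submodule (ZMod 2) (ι → ZMod 2)) (i : ι) (b : ZMod 2)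
    (y : ι → ChannelSymbol) : bitLikelihood C i b y = partialLikelihood C Finset.univ i b y := by
  classical
  unfold bitLikelihood partialLikelihood codewords
  rw [Finset.filter_filter]

/-- Translation by `c` permutes the code and shifts the bit `i` by `c i`, while the channel symmetry
preserves each factor. -/
theorem partialLikelihood_wordOutput {C : Submodule (ZMod 2) (ι → ZMod 2)} (s : Finset ι) (i : ι)
    (b : ZMod 2) {c : ι → ZMod 2} (hc : c ∈ C) (z : ι → ChannelSymbol) :
    partialLikelihood C s i (c i + b) (wordOutput c z) = partialLikelihood C s i b z := by
  unfold partialLikelihood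
  refine (Finset.sum_bij (fun c' _ => c + c') ?_ ?_ ?_ ?_).symm
  · intro c' hc'
    simp only [Finset.mem_filter, mem_codewords] at hc' ⊢
    exact ⟨C.add_mem hc hc'.1, by simp [hc'.2]⟩
  · intro a _ a' _ h
    exact add_left_cancel h
  · intro c' hc'
    simp only [Finset.mem_filter, mem_codewords] at hc'
    refine ⟨-c + c', ?_, by simp⟩
    simp only [Finset.mem_filter, mem_codewords]
    exact ⟨C.add_mem (C.neg_mem hc) hc'.1, by
      rw [Pi.add_apply, Pi.neg_apply, hc'.2, neg_add_cancel_left]⟩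
  · intro c' _
    refine Finset.prod_congr rfl fun j _ => ?_
    exact (transition_add (c j) (c' j) (z j)).symm

theorem measurable_partialLikelihood (C : Submodule (ZMod 2) (ι → ZMod 2)) (s : Finset ι) (i : ι)
    (b : ZMod 2) : Measurable (partialLikelihood C s i b) :=
  Finset.measurable_sum _ fun c _ => Finset.measurable_prod _ fun j _ =>
    (measurable_transition_right (c j)).comp (measurable_pi_apply j)

theorem partialLikelihood_nonneg (C : Submodule (ZMod 2) (ι → ZMod 2)) (s : Finset ι) (i : ι)
    (b : ZMod 2) (y : ι → ChannelSymbol) : 0 ≤ partialLikelihood C s i b y :=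
  Finset.sum_nonneg fun _ _ => Finset.prod_nonneg fun _ _ => transition_nonneg _ _

theorem sum_codewords_eq (C : Submodule (ZMod 2) (ι → ZMod 2)) (i : ι) (w : ZMod 2 → ℝ)
    (y : ι → ChannelSymbol) : ∑ c ∈ codewords C, wordLikelihood c y * w (c i) =
      ∑ b, partialLikelihood C Finset.univ i b y * w b := by
  rw [← Finset.sum_fiberwise (codewords C) fun c => c i]
  refine Finset.sum_congr rfl fun b _ => ?_
  rw [partialLikelihood, Finset.sum_mul]
  refine Finset.sum_congr rfl fun c hc => ?_
  rw [(Finset.mem_filter.1 hc).2]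
  rfl

/-! ### Optimality of maximum likelihood decoding -/

/-- The noise vectors under which the bit `i` of the zero codeword may be decoded wrongly. -/
def failureSet (C : Submodule (ZMod 2) (ι → ZMod 2)) (i : ι) : Set (ι → ChannelSymbol) :=
  {z | partialLikelihood C Finset.univ i 0 z ≤ partialLikelihood C Finset.univ i 1 z}

theorem zmod_two_eq_zero_or_one (x : ZMod 2) : x = 0 ∨ x = 1 := by revert x; decide

theorem eq_add_one_of_ne {x y : ZMod 2} (h : x ≠ y) : x = y + 1 := by revert x y; decide

/-- By translation, an error on any codeword puts the noise into the same `failureSet`, which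
includes the ties. The law of the codeword thus becomes irrelevant. -/
theorem bitErrorProbAt_le {C : Submodule (ZMod 2) (ι → ZMod 2)} (p : PMF C) {i : ι}
    {dec : (ι → ChannelSymbol) → ZMod 2} (hdec : IsMLBitDecoder C i dec) :
    bitErrorProbAt ν C p i dec ≤ (Measure.pi fun _ => noiseLaw ν).real (failureSet C i) := by
  unfold bitErrorProbAt Measure.real
  refine ENNReal.toReal_mono (measure_ne_top _ _) ?_
  have hsub : ∀ c : C, {z | dec (fun j => channelOutput (c.1 j) (z j)) ≠ c.1 i} ⊆
      failureSet C i := by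
    intro c z hz
    have h1 := hdec (wordOutput c.1 z) (c.1 i)
    have h2 : dec (wordOutput c.1 z) = c.1 i + 1 := eq_add_one_of_ne hz
    rw [h2, bitLikelihood_eq, bitLikelihood_eq, partialLikelihood_wordOutput _ _ _ c.2] at h1
    have h3 := partialLikelihood_wordOutput Finset.univ i 0 c.2 z
    rw [add_zero] at h3
    rwa [h3] at h1
  calc ∑' c : C, p c * Measure.pi (fun _ : ι => noiseLaw ν)
        {z | dec (fun j => channelOutput (c.1 j) (z j)) ≠ c.1 i}
      ≤ ∑' c : C, p c * Measure.pi (fun _ : ι => noiseLaw ν) (failureSet C i) :=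
        ENNReal.tsum_le_tsum fun c => mul_le_mul_right (measure_mono (hsub c)) _
    _ = Measure.pi (fun _ : ι => noiseLaw ν) (failureSet C i) := by
        rw [ENNReal.tsum_mul_right, p.tsum_coe, one_mul]

theorem isBddMeasurable_indicator_one {Ω : Type*} [MeasurableSpace Ω] {S : Set Ω}
    (hS : MeasurableSet S) : IsBddMeasurable (S.indicator fun _ => (1 : ℝ)) :=
  ⟨measurable_const.indicator hS, 1, fun z => by
    by_cases h : z ∈ S <;> simp [h]⟩

/-- The bit-error probability of a maximum likelihood decoder, with ties broken in the worst way, is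
at most twice the bit-error probability of any other decoder. -/
theorem measureReal_failureSet_le [DecidableEq ι] (C : Submodule (ZMod 2) (ι → ZMod 2)) (i : ι)
    {D : (ι → ChannelSymbol) → ZMod 2} (hD : Measurable D) {η : ℝ}
    (hη : ∀ c ∈ C, (Measure.pi fun _ => noiseLaw ν).real {z | D (wordOutput c z) ≠ c i} ≤ η) :
    (Measure.pi fun _ => noiseLaw ν).real (failureSet C i) ≤ 2 * η := by
  set P := Measure.pi fun _ : ι => noiseLaw ν with hP
  set A : ZMod 2 → Set (ι → ChannelSymbol) := fun b =>
    {y | partialLikelihood C Finset.univ i b y ≤ partialLikelihood C Finset.univ i (b + 1) y}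
    with hA
  set E : ZMod 2 → Set (ι → ChannelSymbol) := fun b => {y | D y ≠ b} with hE
  have hAm : ∀ b, MeasurableSet (A b) := fun b =>
    measurableSet_le (measurable_partialLikelihood _ _ _ _) (measurable_partialLikelihood _ _ _ _)
  have hEm : ∀ b, MeasurableSet (E b) := fun b =>
    hD (measurableSet_singleton b).compl
  have hint : ∀ c : ι → ZMod 2, ∀ S : Set (ι → ChannelSymbol), MeasurableSet S →
      P.real (wordOutput c ⁻¹' S) = ∫ e, ∑ u, wordLikelihood c (outputOf e u) *
        S.indicator (fun _ => (1 : ℝ)) (outputOf e u) ∂(Measure.pi fun _ => ν) := by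
    intro c S hS
    rw [← integral_wordOutput ν c (isBddMeasurable_indicator_one hS),
      ← integral_indicator_one (measurable_wordOutput c hS)]
    rfl
  have hsum : ∀ S : ZMod 2 → Set (ι → ChannelSymbol), (∀ b, MeasurableSet (S b)) →
      ∑ c ∈ codewords C, P.real (wordOutput c ⁻¹' S (c i)) =
        ∫ e, ∑ u, ∑ b, partialLikelihood C Finset.univ i b (outputOf e u) *
          (S b).indicator (fun _ => (1 : ℝ)) (outputOf e u) ∂(Measure.pi fun _ => ν) := by
    intro S hS
    rw [Finset.sum_congr rfl fun c _ => hint c _ (hS (c i)), ← integral_finsetSum]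
    · refine integral_congr_ae (ae_of_all _ fun e => ?_)
      simp only
      rw [Finset.sum_comm]
      refine Finset.sum_congr rfl fun u _ => ?_
      exact sum_codewords_eq C i (fun b => (S b).indicator (fun _ => (1 : ℝ)) (outputOf e u)) _
    · intro c _
      exact (IsBddMeasurable.sum fun u _ => ((isBddMeasurable_wordLikelihood c).mul
        (isBddMeasurable_indicator_one (hS (c i)))).comp (measurable_outputOf u)).integrable _
  have hbdd : ∀ S : ZMod 2 → Set (ι → ChannelSymbol), (∀ b, MeasurableSet (S b)) →
      Integrable (fun e => ∑ u, ∑ b, partialLikelihood C Finset.univ i b (outputOf e u) *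
          (S b).indicator (fun _ => (1 : ℝ)) (outputOf e u)) (Measure.pi fun _ => ν) := by
    intro S hS
    refine (IsBddMeasurable.sum fun u _ => IsBddMeasurable.sum fun b _ => ?_).integrable _
    exact ((IsBddMeasurable.sum fun c _ => isBddMeasurable_wordLikelihood c).mul
      (isBddMeasurable_indicator_one (hS b))).comp (measurable_outputOf u)
  -- Pointwise in the output: the decoder `D` loses at least the smaller of the two likelihoods,
  -- whereas `A` loses the smaller one, or at a tie both, which is twice the smaller one.
  have hcomp : ∑ c ∈ codewords C, P.real (wordOutput c ⁻¹' A (c i)) ≤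
      2 * ∑ c ∈ codewords C, P.real (wordOutput c ⁻¹' E (c i)) := by
    rw [hsum A hAm, hsum E hEm, ← integral_const_mul]
    refine integral_mono (hbdd A hAm) ((hbdd E hEm).const_mul 2) fun e => ?_
    simp only
    rw [Finset.mul_sum]
    refine Finset.sum_le_sum fun u _ => ?_
    simp only [sum_zmod_two, Set.indicator_apply, hA, hE, Set.mem_ofPred_eq, zero_add,
      show (1 : ZMod 2) + 1 = 0 from rfl]
    have h0 := partialLikelihood_nonneg C Finset.univ i 0 (outputOf e u)
    have h1 := partialLikelihood_nonneg C Finset.univ i 1 (outputOf e u)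
    rcases zmod_two_eq_zero_or_one (D (outputOf e u)) with h | h <;>
      split_ifs <;> first | linarith | simp_all
  have hAeq : ∀ c ∈ codewords C, P.real (wordOutput c ⁻¹' A (c i)) = P.real (failureSet C i) := by
    intro c hc
    congr 1
    ext z
    have h1 := partialLikelihood_wordOutput Finset.univ i 1 (mem_codewords.1 hc) z
    have h0 := partialLikelihood_wordOutput Finset.univ i 0 (mem_codewords.1 hc) z
    rw [add_zero] at h0
    simp only [hA, Set.mem_preimage, Set.mem_ofPred_eq, h0, h1, failureSet]
  rw [Finset.sum_congr rfl hAeq, Finset.sum_const, nsmul_eq_mul] at hcomp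
  have hcard : (0 : ℝ) < (codewords C).card := by rw [card_codewords]; positivity
  have hEle : ∑ c ∈ codewords C, P.real (wordOutput c ⁻¹' E (c i)) ≤ (codewords C).card * η := by
    rw [← nsmul_eq_mul]
    exact Finset.sum_le_card_nsmul _ _ _ fun c hc => hη c (mem_codewords.1 hc)
  refine le_of_mul_le_mul_left ?_ hcard
  linarith

end Transmission

/-! ### Weak prediction of a bit from the other coordinates -/

section Prediction

set_option linter.unusedSectionVars false

variable {ι : Type} [Fintype ι] [DecidableEq ι]

/-- The sign of a bit. -/
noncomputable def bitSign (b : ZMod 2) : ℝ := if b = 0 then 1 else -1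

theorem bitSign_zero : bitSign 0 = 1 := by simp [bitSign]

theorem bitSign_one : bitSign 1 = -1 := by simp [bitSign]

theorem bitSign_mul_self (b : ZMod 2) : bitSign b * bitSign b = 1 := by
  rcases zmod_two_eq_zero_or_one b with rfl | rfl <;> simp [bitSign]

/-- The posterior mean of the sign of the bit `j` of a uniformly random codeword, given the
coordinates of the output other than `j`. -/
noncomputable def bitPredictor (C : Submodule (ZMod 2) (ι → ZMod 2)) (j : ι)
    (y : ι → ChannelSymbol) : ℝ :=
  (partialLikelihood C (Finset.univ.erase j) j 0 y
      - partialLikelihood C (Finset.univ.erase j) j 1 y) /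
    (partialLikelihood C (Finset.univ.erase j) j 0 y
      + partialLikelihood C (Finset.univ.erase j) j 1 y)

theorem measurable_bitPredictor (C : Submodule (ZMod 2) (ι → ZMod 2)) (j : ι) :
    Measurable (bitPredictor C j) :=
  ((measurable_partialLikelihood _ _ _ _).sub (measurable_partialLikelihood _ _ _ _)).div
    ((measurable_partialLikelihood _ _ _ _).add (measurable_partialLikelihood _ _ _ _))

theorem abs_bitPredictor_le_one (C : Submodule (ZMod 2) (ι → ZMod 2)) (j : ι)
    (y : ι → ChannelSymbol) : |bitPredictor C j y| ≤ 1 := by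
  have h0 := partialLikelihood_nonneg C (Finset.univ.erase j) j 0 y
  have h1 := partialLikelihood_nonneg C (Finset.univ.erase j) j 1 y
  unfold bitPredictor
  rw [abs_div, abs_of_nonneg (add_nonneg h0 h1)]
  exact div_le_one_of_le₀ (abs_le.2 ⟨by linarith, by linarith⟩) (add_nonneg h0 h1)

theorem isBddMeasurable_bitPredictor (C : Submodule (ZMod 2) (ι → ZMod 2)) (j : ι) :
    IsBddMeasurable (bitPredictor C j) :=
  ⟨measurable_bitPredictor C j, 1, abs_bitPredictor_le_one C j⟩

theorem bitPredictor_wordOutput {C : Submodule (ZMod 2) (ι → ZMod 2)} (j : ι) {c : ι → ZMod 2}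
    (hc : c ∈ C) (z : ι → ChannelSymbol) :
    bitPredictor C j (wordOutput c z) = bitSign (c j) * bitPredictor C j z := by
  have h0 := partialLikelihood_wordOutput (Finset.univ.erase j) j 0 hc z
  have h1 := partialLikelihood_wordOutput (Finset.univ.erase j) j 1 hc z
  unfold bitPredictor
  rcases zmod_two_eq_zero_or_one (c j) with h | h
  · rw [h, add_zero] at h0
    rw [h, zero_add] at h1
    rw [h, h0, h1, bitSign_zero, one_mul]
  · rw [h, add_zero] at h0
    rw [h, show (1 : ZMod 2) + 1 = 0 from rfl] at h1
    rw [h, h0, h1, bitSign_one]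
    ring

theorem partialLikelihood_congr (C : Submodule (ZMod 2) (ι → ZMod 2)) {s : Finset ι} (i : ι)
    (b : ZMod 2) {y y' : ι → ChannelSymbol} (h : ∀ j ∈ s, y j = y' j) :
    partialLikelihood C s i b y = partialLikelihood C s i b y' :=
  Finset.sum_congr rfl fun c _ => Finset.prod_congr rfl fun j hj => by rw [h j hj]

theorem bitPredictor_congr (C : Submodule (ZMod 2) (ι → ZMod 2)) (i : ι)
    {y y' : ι → ChannelSymbol} (h : ∀ j, j ≠ i → y j = y' j) :
    bitPredictor C i y = bitPredictor C i y' := by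
  have h' : ∀ j ∈ Finset.univ.erase i, y j = y' j := fun j hj => h j (Finset.ne_of_mem_erase hj)
  unfold bitPredictor
  rw [partialLikelihood_congr C i 0 h', partialLikelihood_congr C i 1 h']

theorem partialLikelihood_univ (C : Submodule (ZMod 2) (ι → ZMod 2)) (j : ι) (b : ZMod 2)
    (y : ι → ChannelSymbol) : partialLikelihood C Finset.univ j b y =
      transition b (y j) * partialLikelihood C (Finset.univ.erase j) j b y := by
  unfold partialLikelihood
  rw [Finset.mul_sum]
  refine Finset.sum_congr rfl fun c hc => ?_
  rw [← Finset.mul_prod_erase _ _ (Finset.mem_univ j), (Finset.mem_filter.1 hc).2]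

/-- A product distribution on the cube has the expected marginals. -/
theorem sum_prod_mul_apply (w : ι → ZMod 2 → ℝ) (hw : ∀ j, ∑ v, w j v = 1) (j : ι)
    (φ : ZMod 2 → ℝ) : ∑ u : ι → ZMod 2, (∏ l, w l (u l)) * φ (u j) = ∑ v, w j v * φ v := by
  have h : ∀ u : ι → ZMod 2, (∏ l, w l (u l)) * φ (u j) =
      ∏ l, w l (u l) * (if l = j then φ (u l) else 1) := fun u => by
    rw [Finset.prod_mul_distrib, Finset.prod_ite_eq' Finset.univ j fun l => φ (u l)]
    simp
  rw [Finset.sum_congr rfl fun u _ => h u, ← Fintype.piFinset_univ,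
    ← Finset.prod_univ_sum (fun _ => Finset.univ)
      fun l v => w l v * (if l = j then φ v else 1),
    Finset.prod_eq_single j]
  · simp
  · intro l _ hl
    simp [hl, hw]
  · simp

theorem sum_wordLikelihood (c : ι → ZMod 2) (e : ι → Crossover) :
    ∑ u, wordLikelihood c (outputOf e u) = 1 := by
  unfold wordLikelihood outputOf
  rw [← Fintype.piFinset_univ, ← Finset.prod_univ_sum (fun _ => Finset.univ)
      fun l v => transition (c l) (e l, v)]
  simp [sum_transition]

theorem sum_transition_mul_log (x : ZMod 2) (e : Crossover) :
    ∑ v, transition x (e, v) * Real.log (transition x (e, v)) = -Real.binEntropy e := by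
  rw [Real.binEntropy_eq_negMulLog_add_negMulLog_one_sub, Real.negMulLog, Real.negMulLog]
  rcases zmod_two_eq_zero_or_one x with rfl | rfl <;> simp [sum_zmod_two, transition] <;> ring

theorem sum_wordLikelihood_mul_log (c : ι → ZMod 2) (e : ι → Crossover) :
    ∑ u, wordLikelihood c (outputOf e u) * Real.log (wordLikelihood c (outputOf e u)) =
      -∑ j, Real.binEntropy (e j) := by
  have h : ∀ u, wordLikelihood c (outputOf e u) * Real.log (wordLikelihood c (outputOf e u)) =
      ∑ j, (∏ l, transition (c l) (e l, u l)) * Real.log (transition (c j) (e j, u j)) := by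
    intro u
    rw [← Finset.mul_sum]
    -- If a factor vanishes the logarithm does not split, but both sides carry the zero product.
    by_cases h0 : ∀ j, transition (c j) (e j, u j) ≠ 0
    · rw [← Real.log_prod fun j _ => h0 j]
      rfl
    · push Not at h0
      obtain ⟨j, hj⟩ := h0
      have : wordLikelihood c (outputOf e u) = 0 := Finset.prod_eq_zero (Finset.mem_univ j) hj
      rw [this, show (∏ l, transition (c l) (e l, u l)) = 0 from this]
      simp
  rw [Finset.sum_congr rfl fun u _ => h u, Finset.sum_comm, ← Finset.sum_neg_distrib]
  refine Finset.sum_congr rfl fun j _ => ?_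
  rw [sum_prod_mul_apply (fun l v => transition (c l) (e l, v)) (fun l => sum_transition _ _) j
    fun v => Real.log (transition (c j) (e j, v)), sum_transition_mul_log]

/-- Let `A 0`, `A 1` be the likelihoods of bit `j` given the other outputs. Across an edge in
direction `j`, the two values of `f` sum to `A 0 + A 1` and differ, up to sign, by `(1 - 2ε)(A 0 - A
1)`. The correlation on the right yields the same quotient without the factor `(1 - 2ε) ^ 2 ≤ 1`. -/
theorem half_flipEnergy_le (C : Submodule (ZMod 2) (ι → ZMod 2)) (e : ι → Crossover) (j : ι) :
    flipEnergy j (fun u => ∑ c ∈ codewords C, wordLikelihood c (outputOf e u)) / 2 ≤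
      ∑ u, ∑ c ∈ codewords C, wordLikelihood c (outputOf e u) *
        (bitSign (c j) * bitPredictor C j (outputOf e u)) := by
  set A : ZMod 2 → (ι → ZMod 2) → ℝ := fun b u =>
    partialLikelihood C (Finset.univ.erase j) j b (outputOf e u) with hA
  have hflip : ∀ b u, A b (flipAt j u) = A b u := fun b u =>
    partialLikelihood_congr C j b fun l hl => by
      simp only [outputOf, flipAt_of_ne (Finset.ne_of_mem_erase hl)]
  have hA0 : ∀ b u, 0 ≤ A b u := fun b u => partialLikelihood_nonneg _ _ _ _ _
  have hg : ∀ u, bitPredictor C j (outputOf e u) = (A 0 u - A 1 u) / (A 0 u + A 1 u) :=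
    fun u => rfl
  have hw : ∀ (w : ZMod 2 → ℝ) u, ∑ c ∈ codewords C, wordLikelihood c (outputOf e u) * w (c j) =
      transition 0 (e j, u j) * A 0 u * w 0 + transition 1 (e j, u j) * A 1 u * w 1 := by
    intro w u
    rw [sum_codewords_eq, sum_zmod_two, partialLikelihood_univ, partialLikelihood_univ]
    rfl
  have hf : ∀ u, ∑ c ∈ codewords C, wordLikelihood c (outputOf e u) =
      transition 0 (e j, u j) * A 0 u + transition 1 (e j, u j) * A 1 u := by
    intro u
    simpa using hw (fun _ => 1) u
  have hS : ∀ u, ∑ c ∈ codewords C, wordLikelihood c (outputOf e u) *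
        (bitSign (c j) * bitPredictor C j (outputOf e u)) =
      (transition 0 (e j, u j) * A 0 u - transition 1 (e j, u j) * A 1 u) *
        ((A 0 u - A 1 u) / (A 0 u + A 1 u)) := by
    intro u
    rw [hw (fun b => bitSign b * bitPredictor C j (outputOf e u)), bitSign_zero, bitSign_one, hg]
    ring
  have hR : ∑ u, ∑ c ∈ codewords C, wordLikelihood c (outputOf e u) *
        (bitSign (c j) * bitPredictor C j (outputOf e u)) =
      ∑ u, (A 0 u - A 1 u) ^ 2 / (A 0 u + A 1 u) / 2 := by
    have h2 : ∀ F : (ι → ZMod 2) → ℝ, ∑ u, F u = ∑ u, (F u + F (flipAt j u)) / 2 := fun F => by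
      rw [← Finset.sum_div, Finset.sum_add_distrib, sum_flipAt j F]; ring
    rw [Finset.sum_congr rfl fun u _ => hS u, h2]
    refine Finset.sum_congr rfl fun u _ => ?_
    simp only [hflip, flipAt_self]
    rcases zmod_two_eq_zero_or_one (u j) with h | h <;> rw [h] <;>
      simp [transition, show (1 : ZMod 2) + 1 = 0 from rfl] <;> ring
  rw [hR, flipEnergy, Finset.sum_div]
  refine Finset.sum_le_sum fun u _ => div_le_div_of_nonneg_right ?_ zero_le_two
  simp only [hf, hflip, flipAt_self]
  have he := (e j).2
  have hsum : transition 0 (e j, u j) * A 0 u + transition 1 (e j, u j) * A 1 u +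
      (transition 0 (e j, u j + 1) * A 0 u + transition 1 (e j, u j + 1) * A 1 u) =
      A 0 u + A 1 u := by
    rcases zmod_two_eq_zero_or_one (u j) with h | h <;> rw [h] <;>
      simp [transition, show (1 : ZMod 2) + 1 = 0 from rfl] <;> ring
  have hdiff : (transition 0 (e j, u j) * A 0 u + transition 1 (e j, u j) * A 1 u -
      (transition 0 (e j, u j + 1) * A 0 u + transition 1 (e j, u j + 1) * A 1 u)) ^ 2 =
      (1 - 2 * (e j : ℝ)) ^ 2 * (A 0 u - A 1 u) ^ 2 := by
    rcases zmod_two_eq_zero_or_one (u j) with h | h <;> rw [h] <;>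
      simp [transition, show (1 : ZMod 2) + 1 = 0 from rfl] <;> ring
  rw [hsum, hdiff]
  refine div_le_div_of_nonneg_right ?_ (add_nonneg (hA0 _ _) (hA0 _ _))
  refine mul_le_of_le_one_left (sq_nonneg _) ?_
  rw [sq_le_one_iff_abs_le_one, abs_le]
  constructor <;> linarith [he.1, he.2]

/-- The entropy of the output is at most the logarithm of the number of codewords plus the entropy
of the noise. The resulting deficit from the uniform law feeds the logarithmic Sobolev inequality.
-/
theorem le_sum_codewords_predictor (C : Submodule (ZMod 2) (ι → ZMod 2)) (e : ι → Crossover) :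
    (codewords C).card * (Fintype.card ι * Real.log 2 - Module.finrank (ZMod 2) C * Real.log 2
        - ∑ j, Real.binEntropy (e j)) ≤
      ∑ j, ∑ u, ∑ c ∈ codewords C, wordLikelihood c (outputOf e u) *
        (bitSign (c j) * bitPredictor C j (outputOf e u)) := by
  set f : (ι → ZMod 2) → ℝ := fun u => ∑ c ∈ codewords C, wordLikelihood c (outputOf e u) with hf
  have hf0 : ∀ u, 0 ≤ f u := fun u => Finset.sum_nonneg fun c _ => wordLikelihood_nonneg _ _
  have hcard : (0 : ℝ) < (codewords C).card := by rw [card_codewords]; positivity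
  have hsum : ∑ u, f u = (codewords C).card := by
    simp only [hf]
    rw [Finset.sum_comm]
    simp [sum_wordLikelihood]
  have hlog : Real.log (codewords C).card = Module.finrank (ZMod 2) C * Real.log 2 := by
    rw [card_codewords]; push_cast; rw [Real.log_pow]
  have hent : -((codewords C).card * ∑ j, Real.binEntropy (e j)) ≤
      ∑ u, f u * Real.log (f u) := by
    have h1 : -((codewords C).card * ∑ j, Real.binEntropy (e j)) =
        ∑ u, ∑ c ∈ codewords C, wordLikelihood c (outputOf e u) *
          Real.log (wordLikelihood c (outputOf e u)) := by
      rw [Finset.sum_comm]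
      simp [sum_wordLikelihood_mul_log]
    rw [h1]
    -- Each summand of `f u` is at most `f u`, and the logarithm is monotone.
    refine Finset.sum_le_sum fun u _ => ?_
    rw [hf, Finset.sum_mul]
    refine Finset.sum_le_sum fun c hc => ?_
    rcases eq_or_lt_of_le (wordLikelihood_nonneg c (outputOf e u)) with h | h
    · simp [← h]
    · refine mul_le_mul_of_nonneg_left (Real.log_le_log h ?_) h.le
      exact Finset.single_le_sum (f := fun c => wordLikelihood c (outputOf e u))
        (fun c _ => wordLikelihood_nonneg _ _) hc
  have hmain := entropy_le_sum_flipEnergy hf0 (by rw [hsum]; exact hcard)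
  rw [hsum, hlog, Finset.sum_div] at hmain
  refine le_trans ?_ (hmain.trans (Finset.sum_le_sum fun j _ => half_flipEnergy_le C e j))
  linarith

variable (ν : Measure Crossover) [IsProbabilityMeasure ν]

theorem le_sum_integral_bitPredictor (C : Submodule (ZMod 2) (ι → ZMod 2)) :
    Fintype.card ι * Real.log 2 - Module.finrank (ZMod 2) C * Real.log 2
        - Fintype.card ι * ∫ e, Real.binEntropy (e : ℝ) ∂ν ≤
      ∑ j, ∫ z, bitPredictor C j z ∂(Measure.pi fun _ => noiseLaw ν) := by
  have hcard : (0 : ℝ) < (codewords C).card := by rw [card_codewords]; positivity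
  have hbdd : ∀ c j (u : ι → ZMod 2), IsBddMeasurable fun e : ι → Crossover =>
      wordLikelihood c (outputOf e u) * (bitSign (c j) * bitPredictor C j (outputOf e u)) :=
    fun c j u => ((isBddMeasurable_wordLikelihood c).mul ((IsBddMeasurable.const _).mul
      (isBddMeasurable_bitPredictor C j))).comp (measurable_outputOf u)
  have hj : ∀ j, (codewords C).card *
      ∫ z, bitPredictor C j z ∂(Measure.pi fun _ => noiseLaw ν) =
      ∫ e, ∑ u, ∑ c ∈ codewords C, wordLikelihood c (outputOf e u) *
        (bitSign (c j) * bitPredictor C j (outputOf e u)) ∂(Measure.pi fun _ => ν) := by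
    intro j
    -- The sign of `c j` occurs twice and cancels, so all codewords contribute equally.
    have hc : ∀ c ∈ codewords C, ∫ z, bitPredictor C j z ∂(Measure.pi fun _ => noiseLaw ν) =
        ∫ e, ∑ u, wordLikelihood c (outputOf e u) *
          (bitSign (c j) * bitPredictor C j (outputOf e u)) ∂(Measure.pi fun _ => ν) := by
      intro c hc
      rw [← integral_wordOutput ν c
        ((IsBddMeasurable.const (bitSign (c j))).mul (isBddMeasurable_bitPredictor C j))]
      refine integral_congr_ae (ae_of_all _ fun z => ?_)
      simp only
      rw [bitPredictor_wordOutput j (mem_codewords.1 hc), ← mul_assoc, bitSign_mul_self, one_mul]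
    rw [← nsmul_eq_mul, ← Finset.sum_const, Finset.sum_congr rfl hc, ← integral_finsetSum]
    · refine integral_congr_ae (ae_of_all _ fun e => ?_)
      exact Finset.sum_comm
    · exact fun c _ => (IsBddMeasurable.sum fun u _ => hbdd c j u).integrable _
  have hint : ∀ j : ι, Integrable (fun e : ι → Crossover => Real.binEntropy (e j : ℝ))
      (Measure.pi fun _ => ν) := fun j =>
    integrable_comp_eval (μ := fun _ : ι => ν) (i := j) (integrable_binEntropy ν)
  have hL : ∫ e : ι → Crossover, ((codewords C).card * (Fintype.card ι * Real.log 2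
        - Module.finrank (ZMod 2) C * Real.log 2 - ∑ j, Real.binEntropy (e j)) : ℝ)
        ∂(Measure.pi fun _ => ν) =
      (codewords C).card * (Fintype.card ι * Real.log 2
        - Module.finrank (ZMod 2) C * Real.log 2
        - Fintype.card ι * ∫ e, Real.binEntropy (e : ℝ) ∂ν) := by
    rw [integral_const_mul, integral_sub (integrable_const _)
      (integrable_finsetSum _ fun j _ => hint j), integral_finsetSum _ fun j _ => hint j]
    have : ∀ j : ι, ∫ e : ι → Crossover, Real.binEntropy (e j : ℝ) ∂(Measure.pi fun _ => ν) =
        ∫ e, Real.binEntropy (e : ℝ) ∂ν := fun j =>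
      integral_comp_eval (μ := fun _ : ι => ν) (i := j)
        (integrable_binEntropy ν).aestronglyMeasurable
    simp [this]
  refine le_of_mul_le_mul_left ?_ hcard
  rw [← hL, Finset.mul_sum, Finset.sum_congr rfl fun j _ => hj j, ← integral_finsetSum]
  · refine integral_mono (((integrable_const _).sub
      (integrable_finsetSum _ fun j _ => hint j)).const_mul _) ?_
      fun e => le_sum_codewords_predictor C e
    exact (IsBddMeasurable.sum fun j _ => IsBddMeasurable.sum fun u _ =>
      IsBddMeasurable.sum fun c _ => hbdd c j u).integrable _
  · exact fun j _ => (IsBddMeasurable.sum fun u _ =>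
      IsBddMeasurable.sum fun c _ => hbdd c j u).integrable _

/-- Below capacity, some bit of a random codeword can be weakly predicted from the outputs at the
other coordinates. -/
theorem exists_le_integral_bitPredictor [Nonempty ι] (C : Submodule (ZMod 2) (ι → ZMod 2)) :
    ∃ j, Real.log 2 * (capacity ν - codeRate C) ≤
      ∫ z, bitPredictor C j z ∂(Measure.pi fun _ => noiseLaw ν) := by
  by_contra! h
  have hlt := Finset.sum_lt_sum_of_nonempty Finset.univ_nonempty fun j _ => h j
  have hN : (0 : ℝ) < Fintype.card ι := by exact_mod_cast Fintype.card_pos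
  have h1 := le_sum_integral_bitPredictor ν C
  have h2 := mul_le_mul_of_nonneg_left (capacity_mul_log_two_le ν) hN.le
  have h3 : Fintype.card ι * codeRate C = Module.finrank (ZMod 2) C := by
    rw [codeRate]; field_simp
  rw [Finset.sum_const, nsmul_eq_mul, Finset.card_univ] at hlt
  rw [← h3] at h1
  linarith

end Prediction

/-! ### Boosting over a family of subspaces -/

section Boosting

set_option linter.unusedSectionVars false

variable (ν : Measure Crossover) [IsProbabilityMeasure ν]

/-- A weak predictor for a bit of `RM(m', r)` gives, by a majority vote over the images of an
`m'`-dimensional subspace under multiplication in the field of order `2 ^ m`, a good decoder for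
each bit of `RM(m, r)`. -/
theorem measureReal_failureSet_reedMuller_le {m m' r : ℕ} (hm : m ≠ 0) (hmm : m' ≤ m)
    (j : Fin m' → ZMod 2) {δ : ℝ} (hδ : 0 < δ)
    (hj : δ ≤ ∫ z, bitPredictor (reedMuller m' r) j z ∂(Measure.pi fun _ => noiseLaw ν))
    (i : Fin m → ZMod 2) :
    (Measure.pi fun _ => noiseLaw ν).real (failureSet (reedMuller m r) i) ≤
      2 * (2 ^ m' / (2 ^ m * δ ^ 2)) := by
  classical
  have : Fact (Nat.Prime 2) := ⟨Nat.prime_two⟩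
  let K := GaloisField 2 m
  let _ : Fintype K := Fintype.ofFinite K
  have hrank : Module.finrank (ZMod 2) K = m := GaloisField.finrank 2 hm
  have hcardK : Fintype.card K = 2 ^ m := by
    rw [← Nat.card_eq_fintype_card]; exact GaloisField.card 2 m hm
  obtain ⟨E⟩ : Nonempty (K ≃ₗ[ZMod 2] (Fin m → ZMod 2)) :=
    ⟨LinearEquiv.ofFinrankEq _ _ (by rw [hrank]; simp)⟩
  obtain ⟨T, hT⟩ : ∃ T : (Fin m' → ZMod 2) →ₗ[ZMod 2] K, Function.Injective T :=
    ⟨E.symm.toLinearMap ∘ₗ Function.ExtendByZero.linearMap (ZMod 2) (Fin.castLE hmm),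
      E.symm.injective.comp (by
        intro x y hxy
        funext k
        have h : Function.extend (Fin.castLE hmm) x 0 (Fin.castLE hmm k) =
            Function.extend (Fin.castLE hmm) y 0 (Fin.castLE hmm k) := congr_fun hxy _
        rwa [(Fin.castLE_injective hmm).extend_apply,
          (Fin.castLE_injective hmm).extend_apply] at h)⟩
  let S : Kˣ → ((Fin m' → ZMod 2) →ₗ[ZMod 2] (Fin m → ZMod 2)) := fun a =>
    E.toLinearMap ∘ₗ LinearMap.mulLeft (ZMod 2) (a : K) ∘ₗ T
  have hS : ∀ a w, S a w = E (a * T w) := fun a w => rfl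
  -- The translation sends the predictable coordinate `j` to `i` for every `a`.
  let φ : Kˣ → (Fin m' → ZMod 2) → (Fin m → ZMod 2) := fun a w => S a w + (i - S a j)
  have hφj : ∀ a, φ a j = i := fun a => by simp only [φ]; abel
  have hφ : ∀ a, Function.Injective (φ a) := by
    intro a w w' h
    have h1 : E (a * T w) = E (a * T w') := add_right_cancel h
    exact hT (mul_left_cancel₀ a.ne_zero (E.injective h1))
  let f : Kˣ → ((Fin m → ZMod 2) → ChannelSymbol) → ℝ := fun a z =>
    bitPredictor (reedMuller m' r) j fun w => z (φ a w)
  have hfm : ∀ a, Measurable (f a) := fun a =>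
    (measurable_bitPredictor _ _).comp (by fun_prop)
  have hmean : ∀ a, δ ≤ ∫ z, f a z ∂(Measure.pi fun _ => noiseLaw ν) := by
    intro a
    have hmp := measurePreserving_comp_injective (μ := noiseLaw ν) (hφ a)
    have := integral_map (μ := Measure.pi fun _ => noiseLaw ν) hmp.measurable.aemeasurable
      (measurable_bitPredictor (reedMuller m' r) j).aestronglyMeasurable
    rw [hmp.map_eq] at this
    exact this ▸ hj
  -- For each `w ≠ j` at most one unit sends `w` to `l`, because the nonzero vector `T (w - j)` and
  -- its multiple by `a` determine `a`. The point `j` is excluded since the predictor ignores its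
  -- own coordinate.
  have hQ : ∀ l, ((Finset.univ.filter fun a => ∃ w, w ≠ j ∧ φ a w = l).card : ℝ) ≤
      2 ^ m' - 1 := by
    intro l
    have hle : (Finset.univ.filter fun a => ∃ w, w ≠ j ∧ φ a w = l).card ≤
        (Finset.univ.erase j).card := by
      have hex : ∀ a ∈ Finset.univ.filter fun a => ∃ w, w ≠ j ∧ φ a w = l,
          ∃ w ∈ Finset.univ.erase j, φ a w = l := by
        intro a ha
        obtain ⟨w, hw, hwl⟩ := (Finset.mem_filter.1 ha).2
        exact ⟨w, Finset.mem_erase.2 ⟨hw, Finset.mem_univ _⟩, hwl⟩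
      choose! g hg hgl using hex
      refine Finset.card_le_card_of_injOn g hg fun a ha a' ha' haa => ?_
      have h1 : φ a (g a) = φ a' (g a) := by rw [hgl a ha, haa, hgl a' ha']
      have h2 : ∀ b : Kˣ, φ b (g a) = i + E (b * T (g a - j)) := fun b => by
        simp only [φ, hS, map_sub, mul_sub]; abel
      rw [h2, h2] at h1
      have h3 := E.injective (add_left_cancel h1)
      have h4 : T (g a - j) ≠ 0 := fun h => Finset.ne_of_mem_erase (hg a ha)
        (sub_eq_zero.1 (hT (h.trans (map_zero T).symm)))
      exact Units.ext (mul_right_cancel₀ h4 h3)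
    rw [Finset.card_erase_of_mem (Finset.mem_univ _)] at hle
    have h2 : (Finset.univ : Finset (Fin m' → ZMod 2)).card = 2 ^ m' := by simp
    rw [h2] at hle
    have h3 := Nat.one_le_two_pow (n := m')
    have h4 : ((2 ^ m' - 1 : ℕ) : ℝ) = 2 ^ m' - 1 := by push_cast [h3]; ring
    rw [← h4]
    exact_mod_cast hle
  have h1m' : (1 : ℝ) ≤ 2 ^ m' := one_le_pow₀ one_le_two
  have hcheb := measureReal_sum_nonpos_le (μ := noiseLaw ν) hfm
    (fun a z => abs_bitPredictor_le_one _ _ _)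
    (fun a l => ∃ w, w ≠ j ∧ φ a w = l)
    (fun a l hl z t => bitPredictor_congr _ _ fun w hw =>
      Function.update_of_ne (fun h => hl ⟨w, hw, h⟩) _ _)
    (sub_nonneg.2 h1m') hQ hδ hmean
  have hunits : (Fintype.card Kˣ : ℝ) = 2 ^ m - 1 := by
    rw [Fintype.card_units, hcardK]
    push_cast [Nat.one_le_two_pow (n := m)]
    ring
  have hbound : (2 ^ m' - 1) / ((Fintype.card Kˣ : ℝ) * δ ^ 2) ≤ 2 ^ m' / (2 ^ m * δ ^ 2) := by
    have h1m : (1 : ℝ) < 2 ^ m := one_lt_pow₀ one_lt_two hm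
    have hle : (2 : ℝ) ^ m' ≤ 2 ^ m := pow_le_pow_right₀ one_le_two hmm
    rw [hunits, ← div_div, ← div_div]
    refine div_le_div_of_nonneg_right ?_ (sq_nonneg δ)
    rw [div_le_div_iff₀ (by linarith) (by positivity)]
    nlinarith
  let D : ((Fin m → ZMod 2) → ChannelSymbol) → ZMod 2 := fun y => if 0 < ∑ a, f a y then 0 else 1
  have hD : Measurable D :=
    Measurable.ite (measurableSet_lt measurable_const (Finset.measurable_sum _ fun a _ => hfm a))
      measurable_const measurable_const
  refine measureReal_failureSet_le ν _ i hD fun c hc => ?_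
  refine le_trans (measureReal_mono fun z hz => ?_) (hcheb.trans hbound)
  -- Along `φ a` the codeword restricts to one of `RM(m', r)` whose bit `j` is `c i`, so all votes
  -- change by the same sign. An error of the majority vote therefore forces the sum on the noise
  -- alone to be nonpositive.
  have hsum : ∑ a, f a (wordOutput c z) = bitSign (c i) * ∑ a, f a z := by
    rw [Finset.mul_sum]
    refine Finset.sum_congr rfl fun a _ => ?_
    have := bitPredictor_wordOutput j (comp_affine_mem_reedMuller hc (S a) (i - S a j))
      fun w => z (φ a w)
    rw [show S a j + (i - S a j) = i from hφj a] at this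
    exact this
  have hz' : (if 0 < ∑ a, f a (wordOutput c z) then (0 : ZMod 2) else 1) ≠ c i := hz
  rw [hsum] at hz'
  show ∑ a, f a z ≤ 0
  rcases zmod_two_eq_zero_or_one (c i) with h | h
  · rw [h, bitSign_zero, one_mul] at hz'
    by_contra hcon
    exact hz' (if_pos (not_le.1 hcon))
  · rw [h, bitSign_one] at hz'
    by_contra hcon
    exact hz' (if_neg (by linarith))

theorem bitErrorProb_reedMuller_le {m l r : ℕ} (hm : m ≠ 0) (hl : l ≤ m) {δ : ℝ} (hδ : 0 < δ)
    (hrate : δ ≤ Real.log 2 * (capacity ν - codeRate (reedMuller (m - l) r)))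
    (p : PMF (reedMuller m r))
    (dec : (Fin m → ZMod 2) → ((Fin m → ZMod 2) → ChannelSymbol) → ZMod 2)
    (hdec : ∀ i, IsMLBitDecoder (reedMuller m r) i (dec i)) :
    bitErrorProb ν (reedMuller m r) p dec ≤ 2 / δ ^ 2 * (2 : ℝ) ^ (-(l : ℝ)) := by
  obtain ⟨j, hj⟩ := exists_le_integral_bitPredictor ν (reedMuller (m - l) r)
  refine ciSup_le fun i => (bitErrorProbAt_le ν p (hdec i)).trans ?_
  refine (measureReal_failureSet_reedMuller_le ν hm (Nat.sub_le m l) j hδ (hrate.trans hj)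
    i).trans (le_of_eq ?_)
  have h : (2 : ℝ) ^ m = 2 ^ (m - l) * 2 ^ l := by rw [← pow_add, Nat.sub_add_cancel hl]
  rw [Real.rpow_neg zero_le_two, Real.rpow_natCast, h]
  field_simp

theorem bitErrorProb_nonneg {ι : Type} [Fintype ι] (C : Submodule (ZMod 2) (ι → ZMod 2))
    (p : PMF C) (dec : ι → (ι → ChannelSymbol) → ZMod 2) : 0 ≤ bitErrorProb ν C p dec :=
  Real.iSup_nonneg fun _ => ENNReal.toReal_nonneg

theorem codeRate_le_one {ι : Type} [Fintype ι] (C : Submodule (ZMod 2) (ι → ZMod 2)) :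
    codeRate C ≤ 1 := by
  refine div_le_one_of_le₀ ?_ (Nat.cast_nonneg _)
  have := Submodule.finrank_le C
  rw [Module.finrank_fintype_fun_eq_card] at this
  exact_mod_cast this

end Boosting

/-! ### Choice of the shortening parameter -/

theorem mainTheorem2 (ν : Measure Crossover) [IsProbabilityMeasure ν]
    (m r : ℕ → ℕ) (hm : Tendsto m atTop atTop)
    (hrate : limsup (fun k => codeRate (reedMuller (m k) (r k))) atTop < capacity ν)
    (p : ∀ k, PMF (reedMuller (m k) (r k)))
    (dec : ∀ k, (Fin (m k) → ZMod 2) → ((Fin (m k) → ZMod 2) → ChannelSymbol) → ZMod 2)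
    (hdec : ∀ k i, IsMLBitDecoder (reedMuller (m k) (r k)) i (dec k i)) :
    (fun k => bitErrorProb ν (reedMuller (m k) (r k)) (p k) (dec k)) =O[atTop]
      fun k => (2 : ℝ) ^ (-(√(Real.logb 2 (blockLength (m k)))
        / Real.logb 2 (Real.logb 2 (blockLength (m k))))) := by
  obtain ⟨ρ, hρ1, hρ2⟩ := exists_between hrate
  -- Half of the gap pays for the rate increase `l / √m ≤ δ`; the other half remains as the
  -- advantage of the weak predictor.
  set δ := (capacity ν - ρ) / 2 with hδdef
  have hδ : 0 < δ := by rw [hδdef]; linarith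
  have hlog2 : 0 < Real.log 2 := Real.log_pos one_lt_two
  -- For real sequences this conclusion from the limsup requires boundedness above, here by 1.
  have hev : ∀ᶠ k in atTop, codeRate (reedMuller (m k) (r k)) < ρ :=
    eventually_lt_of_limsup_lt hρ1 ⟨1, by
      simp only [eventually_map]
      exact Eventually.of_forall fun k => codeRate_le_one _⟩
  have hmR : Tendsto (fun k => (m k : ℝ)) atTop atTop := tendsto_natCast_atTop_atTop.comp hm
  have hsqrt : Tendsto (fun k => √(m k : ℝ)) atTop atTop := Real.tendsto_sqrt_atTop.comp hmR
  have hlogm : Tendsto (fun k => Real.logb 2 (m k : ℝ)) atTop atTop :=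
    (Real.tendsto_logb_atTop one_lt_two).comp hmR
  refine Asymptotics.IsBigO.of_bound (2 * (2 / (Real.log 2 * δ) ^ 2)) ?_
  -- The bound `2δ ≤ √m` gives `2l ≤ m`, and `1/δ ≤ log₂ m` gives `√m / log₂ m ≤ δ√m`. Rounding
  -- `δ√m` down to `l` costs the extra factor 2 in the constant.
  filter_upwards [hev, hm.eventually_ge_atTop 1, hsqrt.eventually_ge_atTop (2 * δ),
    hlogm.eventually_ge_atTop (1 / δ)] with k hk hk1 hk2 hk3
  have hm0 : 0 < m k := hk1
  have hs0 : 0 < √(m k : ℝ) := Real.sqrt_pos.2 (by exact_mod_cast hm0)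
  set l := ⌊δ * √(m k : ℝ)⌋₊ with hl
  have hl1 : (l : ℝ) ≤ δ * √(m k : ℝ) := Nat.floor_le (by positivity)
  have hl2 : δ * √(m k : ℝ) < l + 1 := Nat.lt_floor_add_one _
  have h2l : 2 * l ≤ m k := by
    have h1 : (2 * l : ℝ) ≤ m k := by
      have := Real.mul_self_sqrt (Nat.cast_nonneg (α := ℝ) (m k))
      nlinarith
    exact_mod_cast h1
  have hr := codeRate_reedMuller_sub_le (r k) h2l hm0
  have hr2 : (l : ℝ) / √(m k : ℝ) ≤ δ := by rwa [div_le_iff₀ hs0]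
  have hgap : Real.log 2 * δ ≤
      Real.log 2 * (capacity ν - codeRate (reedMuller (m k - l) (r k))) := by
    refine mul_le_mul_of_nonneg_left ?_ hlog2.le
    rw [hδdef] at hr2 ⊢
    linarith
  have hmain := bitErrorProb_reedMuller_le ν hm0.ne' (by omega : l ≤ m k) (mul_pos hlog2 hδ) hgap
    (p k) (dec k) (hdec k)
  have hblock : Real.logb 2 (blockLength (m k)) = m k := by
    rw [blockLength]
    push_cast
    rw [Real.logb_pow, Real.logb_self_eq_one one_lt_two, mul_one]
  rw [Real.norm_of_nonneg (bitErrorProb_nonneg ν _ _ _), Real.norm_of_nonneg (by positivity),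
    hblock]
  refine hmain.trans ?_
  have hexp : (2 : ℝ) ^ (-(l : ℝ)) ≤
      2 * (2 : ℝ) ^ (-(√(m k : ℝ) / Real.logb 2 (m k : ℝ))) := by
    have hdiv : √(m k : ℝ) / Real.logb 2 (m k : ℝ) ≤ δ * √(m k : ℝ) := by
      have hpos : 0 < Real.logb 2 (m k : ℝ) := lt_of_lt_of_le (by positivity) hk3
      rw [div_le_iff₀ hpos]
      have : 1 ≤ δ * Real.logb 2 (m k : ℝ) := by
        rw [div_le_iff₀ hδ] at hk3
        linarith
      nlinarith
    calc (2 : ℝ) ^ (-(l : ℝ))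
        ≤ (2 : ℝ) ^ (1 + -(√(m k : ℝ) / Real.logb 2 (m k : ℝ))) :=
          Real.rpow_le_rpow_of_exponent_le one_le_two (by linarith)
      _ = _ := by rw [Real.rpow_add two_pos, Real.rpow_one]
  calc 2 / (Real.log 2 * δ) ^ 2 * (2 : ℝ) ^ (-(l : ℝ))
      ≤ 2 / (Real.log 2 * δ) ^ 2 *
        (2 * (2 : ℝ) ^ (-(√(m k : ℝ) / Real.logb 2 (m k : ℝ)))) := by gcongr
    _ = _ := by ring
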